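/- Let $S$ be a finite set of states, $\Sigma$ an algebra of subsets of $S$ (events), and $X$ a convex subset of a real vector space (consequences). Let $\mathscr F$ be the set of all acts $f:S\to X$, with pointwise mixtures; a consequence $x\in X$ is identified with the constant act $x$, and $fAg$ is the act equal to $f$ on $A$ and to $g$ on $A^c$. Let $\{\succsim_A\}_{A\in\Sigma}$ be binary relations on $\mathscr F$, with asymmetric and symmetric parts $\succ_A,\sim_A$, and write $\succsim\,=\,\succsim_S$. Let $\Delta(S)$ be the set of probabilities on $S$. For $\pi\in\Delta(S)$ with $\pi(A)>0$ let $\pi_A$ be its Bayesian update, $\pi_A(s)=\pi(s)/\pi(A)$ for $s\in A$ and $0$ otherwise, and let $[\pi_A]$ be the set of all $\hat\pi\in\Delta(S)$ with $\hat\pi(A)>0$ and $\hat\pi_A=\pi_A$. An event $A$ is strongly $\succsim$-nonnull if $xAy\succ y$ for all $x,y\in X$ with $x\succ y$. For $\alpha\in\Delta(S)$ and $f\in\mathscr F$ let $f^\alpha$ be the constant act $\sum_s\alpha(s)f(s)$. For strongly $\succsim$-nonnull $A\in\Sigma$, call $\alpha\in\Delta(S)$ with $\alpha(A)>0$ $A$-maximal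 if $f^\alpha\succsim f$ for all $f\in\mathscr F$, and $\alpha(A)\ge\alpha'(A)$ for every $\alpha'\in[\alpha_A]$ such that $f^{\alpha'}\succsim f$ for all $f\in\mathscr F$; and let $\overline m_A\in[0,1]$ be defined by $\overline m_A\,y+(1-\overline m_A)\,x\sim yAx$ for some $x,y\in X$ with $x\succ y$. A relation on $\mathscr F$ has the MEU representation $(u,\mathscr C)$ if $u:X\to\mathbb R$ is affine and non-constant, $\mathscr C\subseteq\Delta(S)$ is nonempty, closed and convex, and $f$ is weakly preferred to $g$ if and only if $\min_{\pi\in\mathscr C}\sum_s u(f(s))\pi(s)\ge\min_{\pi\in\mathscr C}\sum_s u(g(s))\pi(s)$. Theorem. The following are equivalent. (i) For every strongly $\succsim$-nonnull $A\in\Sigma$ the following hold. 1. (Conditional MEU) The relation $\succsim_A$ satisfies: - weak order: $\succsim_A$ is complete and transitive; - certainty independence: $f\succsim_A g\Leftrightarrow\lambda f+(1-\lambda)x\succsim_A\lambda g+(1-\lambda)x$ for all $f,g\in\mathscr F$, $x\in X$, $\lambda\in(0,1]$; - continuity: if $f\succ_A g\succ_A h$, then $\lambda f+(1-\lambda)h\succ_A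 g\succ_A\gamma f+(1-\gamma)h$ for some $\lambda,\gamma\in(0,1)$; - monotonicity: if $f(s)\succsim_A g(s)$ for all $s\in A$, then $f\succsim_A g$; - ambiguity aversion: if $f\sim_A g$, then $\lambda f+(1-\lambda)g\succsim_A f$ for all $\lambda\in[0,1]$; - non-degeneracy: $f\succ_A g$ for some $f,g\in\mathscr F$; - ordinal preference consistency: $x\succsim y\Leftrightarrow x\succsim_A y$ for all $x,y\in X$. 2. (Consequentialism) If $f(s)=g(s)$ for all $s\in A$, then $f\sim_A g$. 3. (Weak Planning Consistency) For all $f\in\mathscr F$ and $x\in X$, $fAx\succsim x$ implies $f\succsim_A x$. 4. (Monotone Likelihood Reduction Consistency) For every strongly $\succsim$-nonnull $B\in\Sigma$, every $A$-maximal $\alpha$ and every $B$-maximal $\alpha'$ with $\dfrac{\alpha(A)}{\overline m_A}\ge\dfrac{\alpha'(B)}{\overline m_B}$: if $f^{\alpha'_B}\succsim_B f$ for all $f\in\mathscr F$, then $f^{\alpha_A}\succsim_A f$ for all $f\in\mathscr F$. (ii) The collection admits a partial Bayesian updating representation with a constant threshold: there are $u:X\to\mathbb R$, a nonempty, closed,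 convex set $\mathscr C\subseteq\Delta(S)$ and $\rho\in[0,1]$ such that $\succsim$ has the MEU representation $(u,\mathscr C)$ and, for every strongly $\succsim$-nonnull $A\in\Sigma$, $\succsim_A$ has the MEU representation $(u,\mathscr C_A^\rho)$, where $\mathscr C_A^\rho=\{\pi_A\mid\pi\in\mathscr C,\ \pi(A)\ge\rho\max_{\mu\in\mathscr C}\mu(A)\}$. -/

import Mathlib

namespace PartialBayes

open Set

universe v w

section Acts

variable {S : Type v} {V : Type w} [AddCommGroup V] [Module ℝ V] {X : Set V}

/-- A binary relation on acts; an act is a function `S → X`, where the set of consequences `X` is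
a convex subset of the real vector space `V`. `R f g` reads as: `f` is weakly preferred to `g`. -/
abbrev Pref (S : Type v) (X : Set V) := (S → X) → (S → X) → Prop

/-- Strict preference, the asymmetric part of `R`. -/
def Strict (R : Pref S X) (f g : S → X) : Prop := R f g ∧ ¬ R g f

/-- Indifference, the symmetric part of `R`. -/
def Indiff (R : Pref S X) (f g : S → X) : Prop := R f g ∧ R g f

/-- The constant act that yields `x` in every state. -/
def const (S : Type v) (x : X) : S → X := fun _ => x

/-- The mixture `t x + (1 - t) y` of two consequences. -/
def mixX (hX : Convex ℝ X) (t : Icc (0 : ℝ) 1) (x y : X) : X :=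
  ⟨(t : ℝ) • (x : V) + (1 - (t : ℝ)) • (y : V),
    hX x.2 y.2 t.2.1 (sub_nonneg.2 t.2.2) (add_sub_cancel _ _)⟩

/-- The pointwise mixture `t f + (1 - t) g` of two acts. -/
def mix (hX : Convex ℝ X) (t : Icc (0 : ℝ) 1) (f g : S → X) : S → X :=
  fun s => mixX hX t (f s) (g s)

open Classical in
/-- The act `f A g` that agrees with `f` on `A` and with `g` off `A`. -/
noncomputable def splice (A : Set S) (f g : S → X) : S → X :=
  fun s => if s ∈ A then f s else g s

/-- `A` is strongly `R`-nonnull: `x ≻ y` implies `x A y ≻ y`, for all consequences `x`, `y`. -/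
def StronglyNonnull (R : Pref S X) (A : Set S) : Prop :=
  ∀ x y : X, Strict R (const S x) (const S y) →
    Strict R (splice A (const S x) (const S y)) (const S y)

end Acts

section Probability

variable {S : Type v} [Fintype S]

/-- `π(A)`, the sum of `π s` over `s ∈ A`. Probabilities on `S` are the elements of
`stdSimplex ℝ S`. -/
noncomputable def prob (p : S → ℝ) (A : Set S) : ℝ := ∑ s, A.indicator p s

/-- The Bayesian update `π_A`, meant for `π(A) > 0`: `π(s) / π(A)` on `A` and `0` off `A`. -/
noncomputable def bayes (p : S → ℝ) (A : Set S) : S → ℝ :=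
  fun s => A.indicator p s / prob p A

/-- `[π_A]`: the probabilities that give `A` positive weight and have the same update on `A`
as `π`. -/
def sameUpdate (p : S → ℝ) (A : Set S) : Set (S → ℝ) :=
  {q | q ∈ stdSimplex ℝ S ∧ 0 < prob q A ∧ bayes q A = bayes p A}

/-- The largest probability of `A` over the set of priors `C` (attained when `C` is a nonempty
closed set of probabilities). -/
noncomputable def maxProb (C : Set (S → ℝ)) (A : Set S) : ℝ :=
  sSup ((fun p => prob p A) '' C)

/-- The set of posteriors after `A` with threshold `r`: the updates of those priors in `C` whose
likelihood of `A` is at least `r` times the maximal one. -/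
def posteriors (C : Set (S → ℝ)) (r : ℝ) (A : Set S) : Set (S → ℝ) :=
  {q | ∃ p ∈ C, r * maxProb C A ≤ prob p A ∧ q = bayes p A}

end Probability

section Representation

variable {S : Type v} [Fintype S] {V : Type w} [AddCommGroup V] [Module ℝ V] {X : Set V}

/-- The maxmin expected utility of an act: the minimum over `C` of the expected utility (attained
when `C` is a nonempty closed set of probabilities). -/
noncomputable def maxmin (u : X → ℝ) (C : Set (S → ℝ)) (f : S → X) : ℝ :=
  sInf ((fun p : S → ℝ => ∑ s, u (f s) * p s) '' C)

/-- `R` has the maxmin expected utility representation `(u, C)`: `u` is affine and not constant,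
`C` is a nonempty closed convex set of probabilities on `S`, and `R` ranks acts by their maxmin
expected utility. -/
structure IsMEU (hX : Convex ℝ X) (R : Pref S X) (u : X → ℝ) (C : Set (S → ℝ)) : Prop where
  affine : ∀ (t : Icc (0 : ℝ) 1) (x y : X), u (mixX hX t x y) = t * u x + (1 - t) * u y
  nonconstant : ∃ x y : X, u x ≠ u y
  subset : C ⊆ stdSimplex ℝ S
  nonempty : C.Nonempty
  closed : IsClosed C
  convex : Convex ℝ C
  represents : ∀ f g : S → X, R f g ↔ maxmin u C g ≤ maxmin u C f

/-- `(u, C, ρ)` is a partial Bayesian updating representation of the family `pref A`, `A ∈ E`.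
The unconditional preference is `pref univ`. -/
structure IsPB (hX : Convex ℝ X) (E : Set (Set S)) (pref : Set S → Pref S X)
    (u : X → ℝ) (C : Set (S → ℝ)) (ρ : Set S → ℝ) : Prop where
  threshold_mem : ∀ A ∈ E, StronglyNonnull (pref univ) A → ρ A ∈ Icc (0 : ℝ) 1
  prior : IsMEU hX (pref univ) u C
  posterior : ∀ A ∈ E, StronglyNonnull (pref univ) A →
    IsMEU hX (pref A) u (posteriors C (ρ A) A)

/-- The family admits a partial Bayesian updating representation whose threshold is the same for
all events. -/
def HasConstantPB (hX : Convex ℝ X) (E : Set (Set S)) (pref : Set S → Pref S X) : Prop :=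
  ∃ (u : X → ℝ) (C : Set (S → ℝ)) (r : ℝ), r ∈ Icc (0 : ℝ) 1 ∧
    IsPB hX E pref u C (fun _ => r)

end Representation

section Axioms

variable {S : Type v} {V : Type w} [AddCommGroup V] [Module ℝ V] {X : Set V}

/-- Conditional MEU at the event `A`. Here `R₀` is the unconditional preference and `R` the
preference conditional on `A`. -/
structure ConditionalMEU (hX : Convex ℝ X) (R₀ R : Pref S X) (A : Set S) : Prop where
  total : ∀ f g : S → X, R f g ∨ R g f
  trans : ∀ f g h : S → X, R f g → R g h → R f h
  certainty_independence : ∀ (f g : S → X) (x : X) (t : Icc (0 : ℝ) 1), 0 < (t : ℝ) →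
    (R f g ↔ R (mix hX t f (const S x)) (mix hX t g (const S x)))
  continuity : ∀ f g h : S → X, Strict R f g → Strict R g h →
    ∃ t r : Icc (0 : ℝ) 1, (t : ℝ) ∈ Ioo (0 : ℝ) 1 ∧ (r : ℝ) ∈ Ioo (0 : ℝ) 1 ∧
      Strict R (mix hX t f h) g ∧ Strict R g (mix hX r f h)
  monotonicity : ∀ f g : S → X, (∀ s ∈ A, R (const S (f s)) (const S (g s))) → R f g
  ambiguity_aversion : ∀ f g : S → X, Indiff R f g →
    ∀ t : Icc (0 : ℝ) 1, R (mix hX t f g) f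
  nondegeneracy : ∃ f g : S → X, Strict R f g
  ordinal_consistency : ∀ x y : X,
    R₀ (const S x) (const S y) ↔ R (const S x) (const S y)

/-- Consequentialism at the event `A`, for the preference `R` conditional on `A`. -/
def Consequentialism (R : Pref S X) (A : Set S) : Prop :=
  ∀ f g : S → X, (∀ s ∈ A, f s = g s) → Indiff R f g

/-- Weak planning consistency at the event `A`. -/
def WeakPlanningConsistency (R₀ R : Pref S X) (A : Set S) : Prop :=
  ∀ (f : S → X) (x : X), R₀ (splice A f (const S x)) (const S x) → R f (const S x)

/-- `m` is the number `m̄_A`, the subjective maximal probability of `A`: for some `x ≻ y`,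
the constant act `m y + (1 - m) x` is indifferent to the act `y A x`. -/
def IsMaxLikelihood (hX : Convex ℝ X) (R₀ : Pref S X) (A : Set S) (m : Icc (0 : ℝ) 1) : Prop :=
  ∃ x y : X, Strict R₀ (const S x) (const S y) ∧
    Indiff R₀ (const S (mixX hX m y x)) (splice A (const S y) (const S x))

variable [Fintype S]

/-- The outcome of the constant act `f^α`: the mixture of the outcomes of `f` with weights `α`. -/
def reduce (hX : Convex ℝ X) (p : S → ℝ) (hp : p ∈ stdSimplex ℝ S) (f : S → X) : X :=
  ⟨∑ s, p s • (f s : V), hX.sum_mem (fun s _ => hp.1 s) hp.2 (fun s _ => (f s).2)⟩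

/-- `α` is a probability and `f^α` is weakly preferred to `f`, for every act `f`. -/
def AcceptsReduction (hX : Convex ℝ X) (R : Pref S X) (p : S → ℝ) : Prop :=
  ∃ hp : p ∈ stdSimplex ℝ S, ∀ f : S → X, R (const S (reduce hX p hp f)) f

/-- `α` is `A`-maximal: `α(A) > 0`, so that `α_A` makes sense, the reduction by `α` is accepted,
and `α(A) ≥ α'(A)` for every `α' ∈ [α_A]` whose reduction is accepted. -/
def IsMaximal (hX : Convex ℝ X) (R₀ : Pref S X) (A : Set S) (p : S → ℝ) : Prop :=
  0 < prob p A ∧ AcceptsReduction hX R₀ p ∧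
    ∀ q ∈ sameUpdate p A, AcceptsReduction hX R₀ q → prob q A ≤ prob p A

/-- Monotone likelihood reduction consistency for the pair of events `A`, `B`; `R₀`, `RA`, `RB`
are the unconditional preference and the preferences conditional on `A` and on `B`. -/
def MonotoneLikelihoodReduction (hX : Convex ℝ X) (R₀ RA RB : Pref S X) (A B : Set S) : Prop :=
  ∀ (p q : S → ℝ) (mA mB : Icc (0 : ℝ) 1),
    IsMaximal hX R₀ A p → IsMaximal hX R₀ B q →
    IsMaxLikelihood hX R₀ A mA → IsMaxLikelihood hX R₀ B mB →
    prob q B / (mB : ℝ) ≤ prob p A / (mA : ℝ) →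
    AcceptsReduction hX RB (bayes q B) → AcceptsReduction hX RA (bayes p A)

end Axioms

end PartialBayes

namespace PartialBayes

open Set Filter Topology

universe v w


/-! ### Affine utility on a convex set of consequences. -/

section Utility

variable {V : Type w} [AddCommGroup V] [Module ℝ V] {X : Set V}

/-! The axioms first yield an affine utility (`exists_affine_utility`: a positive functional on the
cone of preferred differences) and then, at each strongly nonnull event A, a set of priors `D A`
(`ConditionalMEU.exists_isMEU`, the Gilboa–Schmeidler theorem). Ordinal consistency lets one utility
serve all events; `C` is `D univ`.

In these terms the accepted reductions are exactly the priors (`IsMEU.acceptsReduction_iff`), m̄_A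
is `maxProb C A` (`IsMEU.isMaxLikelihood_iff`), and an A-maximal α is a prior that makes A most
likely among the priors sharing its update. Weak planning consistency says, by separation, that
every element of `D A` is the update of a prior (`IsMEU.exists_bayes_eq`). The last axiom says that
whether an update is kept depends monotonically on the ratio α(A)/m̄_A, on one scale for all events.
The infimum ρ of the ratios of kept updates is therefore a common threshold: above it all updates
are kept, below it none. At ρ itself, if ρ < 1, the update is a limit of kept ones and `D A` is
closed (`bayes_mem_of_forall_lt`); if ρ = 1, its ratio is at least that of any kept update.

Conversely, in a representation with threshold ρ the update of a maximal α is kept if and only if ρ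
is at most its ratio (`IsMEU.bayes_mem_posteriors_iff`), and the last axiom is transitivity of ≤. -/

theorem coe_mixX (hX : Convex ℝ X) (t : Icc (0 : ℝ) 1) (x y : X) :
    (mixX hX t x y : V) = (t : ℝ) • (x : V) + (1 - (t : ℝ)) • (y : V) := rfl

/-- Under independence, the ranking of two consequences depends only on the direction of their
difference. -/
theorem rank_iff_of_sub_eq (hX : Convex ℝ X) {Q : X → X → Prop}
    (indep : ∀ (x y z : X) (t : Icc (0 : ℝ) 1), 0 < (t : ℝ) →
      (Q x y ↔ Q (mixX hX t x z) (mixX hX t y z)))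
    {c : ℝ} (hc : 0 < c) {x y x' y' : X} (h : (x : V) - y = c • ((x' : V) - y')) :
    Q x y ↔ Q x' y' := by
  have h1 : 0 < 1 + c := by linarith
  -- The hypothesis reads x + c y' = y + c x'; division by 1 + c turns both sides into mixtures,
  -- with weights a and b.
  let a : Icc (0 : ℝ) 1 := ⟨1 / (1 + c), by positivity, by rw [div_le_one h1]; linarith⟩
  let b : Icc (0 : ℝ) 1 := ⟨c / (1 + c), by positivity, by rw [div_le_one h1]; linarith⟩
  have ha : 0 < (a : ℝ) := by change 0 < 1 / (1 + c); positivity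
  have hb : 0 < (b : ℝ) := by change 0 < c / (1 + c); positivity
  have hab : 1 - (a : ℝ) = b := by change 1 - 1 / (1 + c) = c / (1 + c); field_simp; ring
  have hba : 1 - (b : ℝ) = a := by linarith
  have hcab : (b : ℝ) = a * c := by change c / (1 + c) = 1 / (1 + c) * c; ring
  have e1 : mixX hX a x y' = mixX hX b x' y := by
    apply Subtype.ext
    have hx : (x : V) = y + c • ((x' : V) - y') := by rw [← h]; abel
    rw [coe_mixX, coe_mixX, hab, hba, hx, hcab]
    module
  have e2 : mixX hX a y y' = mixX hX b y' y := by
    apply Subtype.ext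
    rw [coe_mixX, coe_mixX, hab, hba, add_comm]
  rw [indep x y y' a ha, indep x' y' y b hb, e1, e2]

/-- A nonnegative combination of two differences of consequences is again a multiple of such a
difference, and independence ranks it as the two summands. -/
theorem exists_smul_sub_add_smul_sub (hX : Convex ℝ X) {Q : X → X → Prop}
    (trans : ∀ x y z, Q x y → Q y z → Q x z)
    (indep : ∀ (x y z : X) (t : Icc (0 : ℝ) 1), 0 < (t : ℝ) →
      (Q x y ↔ Q (mixX hX t x z) (mixX hX t y z)))
    {c d : ℝ} (hc : 0 ≤ c) (hd : 0 ≤ d) (x y x' y' : X) :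
    ∃ e : ℝ, 0 ≤ e ∧ ∃ z w : X,
      c • ((x : V) - y) + d • ((x' : V) - y') = e • ((z : V) - w) ∧
      (Q x y → Q x' y' → Q z w) := by
  rcases hc.eq_or_lt with rfl | hc
  · exact ⟨d, hd, x', y', by simp, fun _ h => h⟩
  rcases hd.eq_or_lt with rfl | hd
  · exact ⟨c, hc.le, x, y, by simp, fun h _ => h⟩
  have h1 : 0 < c + d := by linarith
  let a : Icc (0 : ℝ) 1 := ⟨c / (c + d), by positivity, by rw [div_le_one h1]; linarith⟩
  let b : Icc (0 : ℝ) 1 := ⟨d / (c + d), by positivity, by rw [div_le_one h1]; linarith⟩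
  have ha : 0 < (a : ℝ) := by change 0 < c / (c + d); positivity
  have hb : 0 < (b : ℝ) := by change 0 < d / (c + d); positivity
  have hab : 1 - (a : ℝ) = b := by change 1 - c / (c + d) = d / (c + d); field_simp; ring
  have hba : 1 - (b : ℝ) = a := by linarith
  have hca : c = (c + d) * a := by change c = (c + d) * (c / (c + d)); field_simp
  have hdb : d = (c + d) * b := by change d = (c + d) * (d / (c + d)); field_simp
  have comm : ∀ p q : X, mixX hX a p q = mixX hX b q p := fun p q => by
    apply Subtype.ext
    rw [coe_mixX, coe_mixX, hab, hba, add_comm]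
  refine ⟨c + d, h1.le, mixX hX a x x', mixX hX a y y', ?_, fun h h' => ?_⟩
  · rw [coe_mixX, coe_mixX, hab]
    calc c • ((x : V) - y) + d • ((x' : V) - y')
        = ((c + d) * a) • ((x : V) - y) + ((c + d) * b) • ((x' : V) - y') := by rw [← hca, ← hdb]
      _ = _ := by module
  -- The two components are replaced one at a time, each by independence.
  · refine trans _ (mixX hX a y x') _ ((indep _ _ _ _ ha).1 h) ?_
    rw [comm, comm y y']
    exact (indep _ _ _ _ hb).1 h'

/-- The expected utility theorem: an independent and continuous weak order on a convex set that is
not trivial is represented by an affine function. -/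
theorem exists_affine_utility (hX : Convex ℝ X) {Q : X → X → Prop}
    (total : ∀ x y, Q x y ∨ Q y x) (trans : ∀ x y z, Q x y → Q y z → Q x z)
    (indep : ∀ (x y z : X) (t : Icc (0 : ℝ) 1), 0 < (t : ℝ) →
      (Q x y ↔ Q (mixX hX t x z) (mixX hX t y z)))
    (cont : ∀ x y z, ¬ Q y x → ¬ Q z y →
      ∃ t : Icc (0 : ℝ) 1, 0 < (t : ℝ) ∧ (t : ℝ) < 1 ∧ Q (mixX hX t x z) y)
    (nontrivial : ∃ x y, ¬ Q y x) :
    ∃ u : X → ℝ, (∀ (t : Icc (0 : ℝ) 1) (x y : X),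
        u (mixX hX t x y) = t * u x + (1 - t) * u y) ∧
      ∀ x y, Q x y ↔ u y ≤ u x := by
  obtain ⟨x₀, y₀, h₀⟩ := nontrivial
  -- Archimedean property: a strictly positive difference stays positive after subtraction of some
  -- positive multiple of another one. It is continuity applied to the half-half mixtures x x' ≻ y
  -- x' ≻ y y'.
  have arch : ∀ x y x' y' : X, ¬ Q y x → ¬ Q y' x' → ∃ s : ℝ, 0 < s ∧ ∃ k : ℝ, 0 < k ∧
      ∃ z w : X, Q z w ∧ ((x : V) - y) - s • ((x' : V) - y') = k • ((z : V) - w) := by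
    intro x y x' y' h h'
    let a : Icc (0 : ℝ) 1 := ⟨1 / 2, by norm_num, by norm_num⟩
    have ha : (a : ℝ) = 1 / 2 := rfl
    have k1 : ¬ Q (mixX hX a y x') (mixX hX a x x') := by
      rwa [← rank_iff_of_sub_eq hX indep (c := 2) two_pos (x := y) (y := x)]
      rw [coe_mixX, coe_mixX, ha]; module
    have k2 : ¬ Q (mixX hX a y y') (mixX hX a y x') := by
      rwa [← rank_iff_of_sub_eq hX indep (c := 2) two_pos (x := y') (y := x')]
      rw [coe_mixX, coe_mixX, ha]; module
    obtain ⟨t, t0, t1, ht⟩ := cont _ _ _ k1 k2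
    refine ⟨(1 - t) / t, div_pos (by linarith) t0, 2 / t, by positivity, _, _, ht, ?_⟩
    rw [coe_mixX, coe_mixX, coe_mixX, coe_mixX, ha]
    match_scalars <;> field_simp <;> ring
  let D : Submodule ℝ V :=
    { carrier := {v | ∃ c : ℝ, 0 ≤ c ∧ ∃ x y : X, v = c • ((x : V) - y)}
      zero_mem' := ⟨0, le_rfl, x₀, x₀, by simp⟩
      add_mem' := by
        rintro _ _ ⟨c, hc, x, y, rfl⟩ ⟨d, hd, x', y', rfl⟩
        obtain ⟨e, he, z, w, h, -⟩ :=
          exists_smul_sub_add_smul_sub hX trans indep hc hd x y x' y'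
        exact ⟨e, he, z, w, h⟩
      smul_mem' := by
        rintro r _ ⟨c, hc, x, y, rfl⟩
        rcases le_total 0 r with hr | hr
        · exact ⟨r * c, mul_nonneg hr hc, x, y, by rw [mul_smul]⟩
        · exact ⟨-r * c, mul_nonneg (neg_nonneg.2 hr) hc, y, x, by module⟩ }
  let P : ConvexCone ℝ D :=
    { carrier := {v | ∃ c : ℝ, 0 ≤ c ∧ ∃ x y : X, Q x y ∧ (v : V) = c • ((x : V) - y)}
      smul_mem' := by
        rintro r hr v ⟨c, hc, x, y, h, hv⟩
        exact ⟨r * c, mul_nonneg hr.le hc, x, y, h, by rw [mul_smul, ← hv]; rfl⟩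
      add_mem' := by
        rintro v ⟨c, hc, x, y, h, hv⟩ v' ⟨d, hd, x', y', h', hv'⟩
        obtain ⟨e, he, z, w, hzw, hQ⟩ :=
          exists_smul_sub_add_smul_sub hX trans indep hc hd x y x' y'
        exact ⟨e, he, z, w, hQ h h', by rw [← hzw, ← hv, ← hv']; rfl⟩ }
  have memD : ∀ x y : X, (x : V) - y ∈ D := fun x y => ⟨1, zero_le_one, x, y, by simp⟩
  let e : D := ⟨(x₀ : V) - y₀, memD x₀ y₀⟩
  have refl : ∀ x, Q x x := fun x => (total x x).elim id id
  have he : e ≠ 0 := by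
    intro h
    have : (x₀ : V) - y₀ = 0 := congrArg Subtype.val h
    have : x₀ = y₀ := Subtype.ext (sub_eq_zero.1 this)
    exact h₀ (this ▸ refl _)
  have hP : P.Pointed := ⟨0, le_rfl, x₀, x₀, refl x₀, by simp⟩
  -- The functional e ↦ 1 is nonnegative on the multiples of e lying in the cone, since a negative
  -- one would give y₀ ≽ x₀. By `arch`, every element of `D` enters the cone after addition of a
  -- multiple of e.
  obtain ⟨g, hg1, hg2⟩ := riesz_extension (P.toPointedCone hP)
    (LinearPMap.mkSpanSingleton e (1 : ℝ) he) (by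
      rintro ⟨v, hv⟩ ⟨c, hc, x, y, h, hxy⟩
      obtain ⟨r, rfl⟩ := Submodule.mem_span_singleton.1 hv
      rw [LinearPMap.mkSpanSingleton'_apply]
      by_contra hr
      replace hr : r < 0 := by simpa using hr
      have hxy' : r • ((x₀ : V) - y₀) = c • ((x : V) - y) := hxy
      rcases hc.eq_or_lt with rfl | hc
      · rw [zero_smul] at hxy'
        exact (smul_ne_zero hr.ne he) (Subtype.ext hxy')
      · refine h₀ ((rank_iff_of_sub_eq hX indep (c := c / (-r))
          (div_pos hc (by linarith)) ?_).2 h)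
        have : (x₀ : V) - y₀ = (r⁻¹ * c) • ((x : V) - y) := by
          rw [mul_smul, ← hxy', inv_smul_smul₀ hr.ne]
        rw [← neg_sub, this, div_neg, neg_smul, div_eq_inv_mul]) (by
      rintro ⟨v, c, hc, x, y, rfl⟩
      rcases hc.eq_or_lt with rfl | hc
      · exact ⟨0, 0, le_rfl, x, x, refl x, by simp⟩
      by_cases h : Q x y
      · exact ⟨0, c, hc.le, x, y, h, by simp⟩
      obtain ⟨s, hs, k, hk, z, w, hzw, heq⟩ := arch x₀ y₀ y x h₀ h
      refine ⟨⟨(c / s) • e, Submodule.smul_mem _ _ (Submodule.mem_span_singleton_self e)⟩,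
        (c / s) * k, by positivity, z, w, hzw, ?_⟩
      rw [mul_smul, ← heq]
      change (c / s) • ((x₀ : V) - y₀) + c • ((x : V) - y) = _
      match_scalars <;> field_simp)
  obtain ⟨G, hG⟩ := g.exists_extend
  have hGD : ∀ v (hv : v ∈ D), G v = g ⟨v, hv⟩ := fun v hv => by rw [← hG]; rfl
  have hGe : G ((x₀ : V) - y₀) = 1 := by
    rw [hGD _ (memD x₀ y₀)]
    have := hg1 ⟨e, Submodule.mem_span_singleton_self e⟩
    refine this.trans ?_
    exact LinearPMap.mkSpanSingleton_apply ℝ ℝ he 1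
  have hGnn : ∀ x y : X, Q x y → G (y : V) ≤ G x := fun x y h => by
    have := hg2 ⟨(x : V) - y, memD x y⟩ ⟨1, zero_le_one, x, y, h, by simp⟩
    rw [← hGD, map_sub] at this
    linarith
  refine ⟨fun x => G x, fun t x y => ?_, fun x y => ⟨hGnn x y, fun h => ?_⟩⟩
  · simp only [coe_mixX, map_add, map_smul, smul_eq_mul]
  · by_contra hQ
    -- If y ≻ x, then y - x exceeds s e by an element of the cone, so `G` is larger at y than at x
    -- by at least s > 0.
    obtain ⟨s, hs, k, hk, z, w, hzw, heq⟩ := arch y x x₀ y₀ hQ h₀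
    have h1 := congrArg G heq
    simp only [map_sub, map_smul, smul_eq_mul] at h1 hGe
    rw [hGe] at h1
    have h2 := mul_nonneg hk.le (sub_nonneg.2 (hGnn z w hzw))
    linarith

end Utility


/-! ### Minimal expected utility over a set of priors. -/

section Maxmin

variable {S : Type v} [Fintype S] {V : Type w} {X : Set V}

/-- Hahn–Banach separation in coordinates: the functional is a vector `φ` over states, which can be
realized, up to scale and level, as the utility profile of an act. -/
theorem exists_sum_mul_lt {C : Set (S → ℝ)} (hconv : Convex ℝ C) (hclosed : IsClosed C)
    {p : S → ℝ} (hp : p ∉ C) :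
    ∃ (φ : S → ℝ) (c : ℝ), ∑ s, φ s * p s < c ∧ ∀ q ∈ C, c < ∑ s, φ s * q s := by
  classical
  obtain ⟨l, c, h1, h2⟩ := geometric_hahn_banach_point_closed hconv hclosed hp
  have hl : ∀ q : S → ℝ, l q = ∑ s, l (Pi.single s 1) * q s := fun q => by
    have := LinearMap.pi_apply_eq_sum_univ (l : (S → ℝ) →ₗ[ℝ] ℝ) q
    simp only [ContinuousLinearMap.coe_coe, smul_eq_mul] at this
    rw [this]
    refine Finset.sum_congr rfl fun s _ => ?_
    rw [mul_comm]
    congr 2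
    ext i
    simp [Pi.single_apply, eq_comm]
  exact ⟨fun s => l (Pi.single s 1), c, by rwa [← hl], fun q hq => by rw [← hl]; exact h2 q hq⟩

theorem continuous_sum_mul (φ : S → ℝ) : Continuous fun p : S → ℝ => ∑ s, φ s * p s := by
  fun_prop

theorem sum_const_mul_of_mem_stdSimplex {p : S → ℝ} (hp : p ∈ stdSimplex ℝ S) (c : ℝ) :
    ∑ s, c * p s = c := by
  rw [← Finset.mul_sum, hp.2, mul_one]

theorem isCompact_of_subset_stdSimplex {C : Set (S → ℝ)} (hsub : C ⊆ stdSimplex ℝ S)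
    (hclosed : IsClosed C) : IsCompact C :=
  (isCompact_stdSimplex ℝ S).of_isClosed_subset hclosed hsub

theorem bddBelow_image_sum_mul {C : Set (S → ℝ)} (hsub : C ⊆ stdSimplex ℝ S) (φ : S → ℝ) :
    BddBelow ((fun p : S → ℝ => ∑ s, φ s * p s) '' C) :=
  ((isCompact_stdSimplex ℝ S).image (continuous_sum_mul φ)).bddBelow.mono (image_mono hsub)

theorem le_maxmin_iff {u : X → ℝ} {C : Set (S → ℝ)} (hsub : C ⊆ stdSimplex ℝ S)
    (hne : C.Nonempty) {f : S → X} {c : ℝ} :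
    c ≤ maxmin u C f ↔ ∀ p ∈ C, c ≤ ∑ s, u (f s) * p s := by
  rw [maxmin, le_csInf_iff (bddBelow_image_sum_mul hsub fun s => u (f s)) (hne.image _)]
  simp

theorem maxmin_le_sum {u : X → ℝ} {C : Set (S → ℝ)} (hsub : C ⊆ stdSimplex ℝ S)
    {f : S → X} {p : S → ℝ} (hp : p ∈ C) : maxmin u C f ≤ ∑ s, u (f s) * p s :=
  (le_maxmin_iff hsub ⟨p, hp⟩).1 le_rfl p hp

theorem exists_maxmin_eq_sum {u : X → ℝ} {C : Set (S → ℝ)} (hsub : C ⊆ stdSimplex ℝ S)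
    (hne : C.Nonempty) (hclosed : IsClosed C) (f : S → X) :
    ∃ p ∈ C, maxmin u C f = ∑ s, u (f s) * p s := by
  obtain ⟨p, hp, h⟩ := (isCompact_of_subset_stdSimplex hsub hclosed).exists_isMinOn hne
    (continuous_sum_mul fun s => u (f s)).continuousOn
  exact ⟨p, hp, (maxmin_le_sum hsub hp).antisymm
    ((le_maxmin_iff hsub hne).2 fun q hq => isMinOn_iff.1 h q hq)⟩

theorem maxmin_const {u : X → ℝ} {C : Set (S → ℝ)} (hsub : C ⊆ stdSimplex ℝ S)
    (hne : C.Nonempty) (x : X) : maxmin u C (const S x) = u x := by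
  have h : ∀ p ∈ C, ∑ s, u (const S x s) * p s = u x := fun p hp =>
    sum_const_mul_of_mem_stdSimplex (hsub hp) (u x)
  obtain ⟨p, hp⟩ := hne
  refine le_antisymm ((maxmin_le_sum hsub hp).trans_eq (h p hp)) ?_
  exact (le_maxmin_iff hsub ⟨p, hp⟩).2 fun q hq => (h q hq).ge

variable [AddCommGroup V] [Module ℝ V] {hX : Convex ℝ X} {u : X → ℝ}

theorem exists_utility_eq
    (haff : ∀ (t : Icc (0 : ℝ) 1) (x y : X), u (mixX hX t x y) = t * u x + (1 - t) * u y)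
    {a b : X} {c : ℝ} (h1 : u a ≤ c) (h2 : c ≤ u b) : ∃ x, u x = c := by
  rcases (h1.trans h2).eq_or_lt with h | h
  · exact ⟨a, by linarith⟩
  have h0 : 0 < u b - u a := by linarith
  refine ⟨mixX hX ⟨(c - u a) / (u b - u a), div_nonneg (by linarith) h0.le,
    by rw [div_le_one h0]; linarith⟩ b a, ?_⟩
  rw [haff]
  field_simp
  ring

/-- Around some interior utility level, all small utility profiles are profiles of acts. -/
theorem exists_act_of_profile
    (haff : ∀ (t : Icc (0 : ℝ) 1) (x y : X), u (mixX hX t x y) = t * u x + (1 - t) * u y)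
    (hnc : ∃ x y : X, u x ≠ u y) :
    ∃ o : X, ∀ φ : S → ℝ, ∃ t₀ : ℝ, 0 < t₀ ∧ ∀ t, 0 < t → t ≤ t₀ →
      ∃ f : S → X, ∀ s, u (f s) = u o + t * φ s := by
  obtain ⟨a, b, hab⟩ : ∃ a b : X, u a < u b := by
    obtain ⟨x, y, h⟩ := hnc
    exact h.lt_or_gt.elim (fun h => ⟨x, y, h⟩) fun h => ⟨y, x, h⟩
  obtain ⟨o, ho⟩ := exists_utility_eq haff (a := a) (b := b) (c := (u a + u b) / 2)
    (by linarith) (by linarith)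
  refine ⟨o, fun φ => ?_⟩
  have hM : ∀ s, |φ s| ≤ ∑ s, |φ s| := fun s =>
    Finset.single_le_sum (f := fun s => |φ s|) (fun _ _ => abs_nonneg _) (Finset.mem_univ s)
  have hM0 : 0 ≤ ∑ s, |φ s| := Finset.sum_nonneg fun _ _ => abs_nonneg _
  -- The level of `o` is the midpoint, with half the utility gap free on either side; the `+ 1`
  -- covers `φ = 0`.
  have hpos : 0 < (u b - u a) / 2 / (∑ s, |φ s| + 1) := by
    apply div_pos <;> linarith
  refine ⟨_, hpos, fun t ht htle => ?_⟩
  have key : ∀ s, ∃ x, u x = u o + t * φ s := fun s => by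
    rw [le_div_iff₀ (by linarith)] at htle
    have h1 : |t * φ s| ≤ (u b - u a) / 2 := by
      rw [abs_mul, abs_of_pos ht]
      have := mul_le_mul_of_nonneg_left (hM s) ht.le
      linarith
    have h2 := abs_le.1 h1
    exact exists_utility_eq haff (a := a) (b := b) (by linarith [h2.1]) (by linarith [h2.2])
  choose f hf using key
  exact ⟨f, hf⟩

end Maxmin

/-! ### The Gilboa–Schmeidler theorem through the cone of acceptable profiles. -/

section Acceptable

variable {S : Type v} {V : Type w} {X : Set V}

/-- The utility profiles, relative to the level `u o`, of acts weakly preferred to `o`, and their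
positive multiples. -/
def acceptable (R : Pref S X) (u : X → ℝ) (o : X) : Set (S → ℝ) :=
  {φ | ∃ t : ℝ, 0 < t ∧ ∃ f : S → X, (∀ s, u (f s) = u o + t * φ s) ∧ R f (const S o)}

theorem smul_mem_acceptable {R : Pref S X} {u : X → ℝ} {o : X} {φ : S → ℝ}
    (hφ : φ ∈ acceptable R u o) {c : ℝ} (hc : 0 < c) : c • φ ∈ acceptable R u o := by
  obtain ⟨t, ht, f, hf, hR⟩ := hφ
  exact ⟨t / c, div_pos ht hc, f, fun s => by
    rw [hf, Pi.smul_apply, smul_eq_mul]; field_simp, hR⟩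

end Acceptable

section GilboaSchmeidler

variable {S : Type v} {V : Type w} [AddCommGroup V] [Module ℝ V] {X : Set V}
  {hX : Convex ℝ X} {R₀ R : Pref S X} {A : Set S} {u : X → ℝ}

theorem ConditionalMEU.refl (h : ConditionalMEU hX R₀ R A) (f : S → X) : R f f :=
  (h.total f f).elim id id

theorem ConditionalMEU.of_le (h : ConditionalMEU hX R₀ R A)
    (hu : ∀ x y : X, R (const S x) (const S y) ↔ u y ≤ u x)
    {f g : S → X} (hfg : ∀ s, u (g s) ≤ u (f s)) : R f g :=
  h.monotonicity f g fun s _ => (hu _ _).2 (hfg s)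

theorem ConditionalMEU.congr (h : ConditionalMEU hX R₀ R A)
    (hu : ∀ x y : X, R (const S x) (const S y) ↔ u y ≤ u x)
    {f g f' g' : S → X} (hf : ∀ s, u (f s) = u (f' s)) (hg : ∀ s, u (g s) = u (g' s)) :
    R f g ↔ R f' g' :=
  ⟨fun H => h.trans _ _ _ (h.of_le hu fun s => (hf s).le)
      (h.trans _ _ _ H (h.of_le hu fun s => (hg s).ge)),
    fun H => h.trans _ _ _ (h.of_le hu fun s => (hf s).ge)
      (h.trans _ _ _ H (h.of_le hu fun s => (hg s).le))⟩

/-- The ranking of two acts is invariant under common positive affine transformations of their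
utility profiles. -/
theorem ConditionalMEU.iff_of_affine (h : ConditionalMEU hX R₀ R A)
    (haff : ∀ (t : Icc (0 : ℝ) 1) (x y : X), u (mixX hX t x y) = t * u x + (1 - t) * u y)
    (hu : ∀ x y : X, R (const S x) (const S y) ↔ u y ≤ u x)
    {f g f' g' : S → X} {x x' : X} {c : ℝ} (hc : 0 < c)
    (hf : ∀ s, u (f s) - u x = c * (u (f' s) - u x'))
    (hg : ∀ s, u (g s) - u x = c * (u (g' s) - u x')) :
    R f g ↔ R f' g' := by
  have h1 : 0 < 1 + c := by linarith
  let a : Icc (0 : ℝ) 1 := ⟨1 / (1 + c), by positivity, by rw [div_le_one h1]; linarith⟩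
  let b : Icc (0 : ℝ) 1 := ⟨c / (1 + c), by positivity, by rw [div_le_one h1]; linarith⟩
  have ha' : (a : ℝ) = 1 / (1 + c) := rfl
  have hb' : (b : ℝ) = c / (1 + c) := rfl
  have ha : 0 < (a : ℝ) := by rw [ha']; positivity
  have hb : 0 < (b : ℝ) := by rw [hb']; positivity
  -- The weights 1/(1+c) and c/(1+c) give the two mixtures equal profiles, so certainty independence
  -- links the two rankings.
  have key : ∀ {p p' : S → X}, (∀ s, u (p s) - u x = c * (u (p' s) - u x')) → ∀ s,
      u (mix hX a p (const S x') s) = u (mix hX b p' (const S x) s) := fun {p p'} hp s => by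
    have hps : u (p s) = u x + c * (u (p' s) - u x') := by rw [← hp s]; ring
    simp only [mix, const, haff, ha', hb', hps]
    field_simp
    ring
  rw [h.certainty_independence f g x' a ha, h.certainty_independence f' g' x b hb]
  exact h.congr hu (key hf) (key hg)

/-- `u` is an affine utility for the conditional preference `R`, with a consequence `o` around whose
utility level all small utility profiles are profiles of acts. -/
structure Calibrated (hX : Convex ℝ X) (R₀ R : Pref S X) (A : Set S) (u : X → ℝ) (o : X) :
    Prop where
  meu : ConditionalMEU hX R₀ R A
  affine : ∀ (t : Icc (0 : ℝ) 1) (x y : X), u (mixX hX t x y) = t * u x + (1 - t) * u y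
  represents : ∀ x y : X, R (const S x) (const S y) ↔ u y ≤ u x
  room : ∀ φ : S → ℝ, ∃ t₀ : ℝ, 0 < t₀ ∧ ∀ t, 0 < t → t ≤ t₀ →
    ∃ f : S → X, ∀ s, u (f s) = u o + t * φ s

namespace Calibrated

variable {o : X}

theorem exists_act (K : Calibrated hX R₀ R A u o) (φ : S → ℝ) :
    ∃ t : ℝ, 0 < t ∧ ∃ f : S → X, ∀ s, u (f s) = u o + t * φ s := by
  obtain ⟨t, ht, H⟩ := K.room φ
  exact ⟨t, ht, H t ht le_rfl⟩

theorem iff_of_profile (K : Calibrated hX R₀ R A u o)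
    {φ : S → ℝ} {t t' : ℝ} (ht : 0 < t) (ht' : 0 < t') {f f' : S → X}
    {x x' : X} (hf : ∀ s, u (f s) = u x + t * φ s) (hf' : ∀ s, u (f' s) = u x' + t' * φ s) :
    (R f (const S x) ↔ R f' (const S x')) ∧ (R (const S x) f ↔ R (const S x') f') := by
  have h1 : ∀ s, u (f s) - u x = t / t' * (u (f' s) - u x') := fun s => by
    rw [hf, hf']; field_simp; ring
  have h2 : ∀ s, u (const S x s) - u x = t / t' * (u (const S x' s) - u x') := fun s => by
    simp [const]
  exact ⟨K.meu.iff_of_affine K.affine K.represents (div_pos ht ht') h1 h2,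
    K.meu.iff_of_affine K.affine K.represents (div_pos ht ht') h2 h1⟩

/-- Certainty independence makes scale and reference level irrelevant, so acceptability of a profile
can be tested on any single act realizing it, at any level. -/
theorem mem_acceptable_iff (K : Calibrated hX R₀ R A u o)
    {φ : S → ℝ} {t : ℝ} (ht : 0 < t) {f : S → X} {x : X}
    (hf : ∀ s, u (f s) = u x + t * φ s) :
    φ ∈ acceptable R u o ↔ R f (const S x) := by
  constructor
  · rintro ⟨t', ht', f', hf', hR⟩
    exact (K.iff_of_profile ht' ht hf' hf).1.1 hR
  · intro hR
    obtain ⟨t', ht', f', hf'⟩ := K.exists_act φ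
    exact ⟨t', ht', f', hf', (K.iff_of_profile ht' ht hf' hf).1.2 hR⟩

theorem acceptable_mono (K : Calibrated hX R₀ R A u o)
    {φ ψ : S → ℝ} (hφ : φ ∈ acceptable R u o) (hle : φ ≤ ψ) :
    ψ ∈ acceptable R u o := by
  obtain ⟨t₁, ht₁, H₁⟩ := K.room φ
  obtain ⟨t₂, ht₂, H₂⟩ := K.room ψ
  have ht : 0 < min t₁ t₂ := lt_min ht₁ ht₂
  obtain ⟨f, hf⟩ := H₁ _ ht (min_le_left _ _)
  obtain ⟨g, hg⟩ := H₂ _ ht (min_le_right _ _)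
  refine ⟨_, ht, g, hg, K.meu.trans _ _ _ (K.meu.of_le K.represents fun s => ?_)
    ((K.mem_acceptable_iff ht hf).1 hφ)⟩
  rw [hf, hg]
  have := mul_le_mul_of_nonneg_left (hle s) ht.le
  linarith

theorem zero_mem_acceptable (K : Calibrated hX R₀ R A u o) : (0 : S → ℝ) ∈ acceptable R u o :=
  ⟨1, one_pos, const S o, fun s => by simp [const], K.meu.refl _⟩

theorem const_mem_acceptable_iff (K : Calibrated hX R₀ R A u o) [Nonempty S] {c : ℝ} :
    (fun _ => c : S → ℝ) ∈ acceptable R u o ↔ 0 ≤ c := by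
  obtain ⟨t, ht, f, hf⟩ := K.exists_act (fun _ => c)
  obtain ⟨s₀⟩ := ‹Nonempty S›
  have h1 : R f (const S o) ↔ R (const S (f s₀)) (const S o) :=
    K.meu.congr K.represents (fun s => by rw [hf]; exact (hf s₀).symm) fun _ => rfl
  rw [K.mem_acceptable_iff ht hf, h1, K.represents, hf]
  constructor
  · intro h
    by_contra hc
    have := mul_neg_of_pos_of_neg ht (not_le.1 hc)
    linarith
  · intro h
    have := mul_nonneg ht.le h
    linarith

theorem exists_utility (K : Calibrated hX R₀ R A u o) (c : ℝ) [Nonempty S] :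
    ∃ (x : X) (t : ℝ), 0 < t ∧ u x = u o + t * c := by
  obtain ⟨t, ht, f, hf⟩ := K.exists_act (fun _ => c)
  exact ⟨f (Classical.arbitrary S), t, ht, hf _⟩

/-- If f ≺ o ≺ x, continuity gives a mixture of x and f still strictly worse than o; its profile is,
up to scale, `φ` raised by a constant. This is what makes the cone closed. -/
theorem exists_add_notMem (K : Calibrated hX R₀ R A u o)
    [Nonempty S] {φ : S → ℝ} (hφ : φ ∉ acceptable R u o) :
    ∃ ε : ℝ, 0 < ε ∧ (fun s => φ s + ε) ∉ acceptable R u o := by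
  obtain ⟨t, ht, f, hf⟩ := K.exists_act φ
  have hR := mt (K.mem_acceptable_iff ht hf).2 hφ
  obtain ⟨x, τ, hτ, hx⟩ := K.exists_utility 1
  have hxo : ¬ R (const S o) (const S x) := by
    rw [K.represents]; linarith
  obtain ⟨-, r, -, ⟨hr0, hr1⟩, -, h⟩ := K.meu.continuity (const S x) (const S o) f
    ⟨(K.meu.total _ _).resolve_left hxo, hxo⟩ ⟨(K.meu.total _ _).resolve_left hR, hR⟩
  have hr : 0 < (1 - (r : ℝ)) * t := mul_pos (by linarith) ht
  refine ⟨r * τ / ((1 - r) * t), by positivity, fun hmem => h.2 ?_⟩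
  refine (K.mem_acceptable_iff hr fun s => ?_).1 hmem
  simp only [mix, K.affine, const, hx, hf]
  field_simp
  ring

theorem exists_sub_mem (K : Calibrated hX R₀ R A u o)
    [Nonempty S] {φ : S → ℝ} {t : ℝ} (ht : 0 < t) {f : S → X}
    (hf : ∀ s, u (f s) = u o + t * φ s) (hR : ¬ R (const S o) f) :
    ∃ ε : ℝ, 0 < ε ∧ (fun s => φ s - ε) ∈ acceptable R u o := by
  obtain ⟨x, τ, hτ, hx⟩ := K.exists_utility (-1)
  have hxo : ¬ R (const S x) (const S o) := by
    rw [K.represents]; linarith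
  obtain ⟨r, -, ⟨hr0, hr1⟩, -, h, -⟩ := K.meu.continuity f (const S o) (const S x)
    ⟨(K.meu.total _ _).resolve_left hR, hR⟩ ⟨(K.meu.total _ _).resolve_left hxo, hxo⟩
  have hr : 0 < 1 - (r : ℝ) := by linarith
  refine ⟨(1 - r) * τ / (r * t), by positivity,
    (K.mem_acceptable_iff (t := r * t) (by positivity) fun s => ?_).2 h.1⟩
  simp only [mix, K.affine, const, hx, hf]
  field_simp
  ring

variable [Fintype S]

theorem isClosed_acceptable (K : Calibrated hX R₀ R A u o)
    [Nonempty S] : IsClosed (acceptable R u o) := by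
  rw [← isOpen_compl_iff, Metric.isOpen_iff]
  intro φ hφ
  obtain ⟨ε, hε, h⟩ := K.exists_add_notMem hφ
  refine ⟨ε, hε, fun ψ hψ hmem => h (K.acceptable_mono hmem fun s => ?_)⟩
  have := (dist_pi_lt_iff hε).1 hψ s
  rw [Real.dist_eq] at this
  linarith [(abs_lt.1 this).2]

/-- Every acceptable profile exceeds by a nonnegative constant one that is just acceptable. -/
theorem exists_sub_indiff (K : Calibrated hX R₀ R A u o)
    [Nonempty S] {φ : S → ℝ} (hφ : φ ∈ acceptable R u o) :
    ∃ c : ℝ, 0 ≤ c ∧ ∀ t : ℝ, 0 < t → ∀ f : S → X, (∀ s, u (f s) = u o + t * (φ s - c)) →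
      Indiff R f (const S o) := by
  -- The constant is the largest that can be subtracted. The supremum is attained by closedness, and
  -- strict preference at it would allow a further ε.
  let T : Set ℝ := {c | (fun s => φ s - c) ∈ acceptable R u o}
  have hT0 : (0 : ℝ) ∈ T := by simpa [T] using hφ
  have hTclosed : IsClosed T :=
    K.isClosed_acceptable.preimage (f := fun c : ℝ => fun s => φ s - c) (by fun_prop)
  have hTbdd : BddAbove T := by
    obtain ⟨M, hM⟩ := (Set.finite_range φ).bddAbove
    refine ⟨M, fun c hc => ?_⟩
    have := K.acceptable_mono (ψ := fun _ => M - c) hc fun s => by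
      have := hM (mem_range_self s)
      simpa using this
    exact sub_nonneg.1 (K.const_mem_acceptable_iff.1 this)
  have hmem : sSup T ∈ T := hTclosed.csSup_mem ⟨0, hT0⟩ hTbdd
  refine ⟨sSup T, le_csSup hTbdd hT0, fun t ht f hf =>
    ⟨(K.mem_acceptable_iff ht hf).1 hmem, ?_⟩⟩
  by_contra hR
  obtain ⟨ε, hε, h⟩ := K.exists_sub_mem ht hf hR
  have : sSup T + ε ∈ T := by
    simpa [T, sub_sub] using h
  linarith [le_csSup hTbdd this]

/-- Ambiguity aversion applies only to indifferent acts. Both profiles are therefore first lowered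
by constants until just acceptable, then mixed half-half; monotonicity restores the constants. -/
theorem add_mem_acceptable (K : Calibrated hX R₀ R A u o)
    [Nonempty S] {φ ψ : S → ℝ} (hφ : φ ∈ acceptable R u o)
    (hψ : ψ ∈ acceptable R u o) : φ + ψ ∈ acceptable R u o := by
  obtain ⟨c, hc, H₁⟩ := K.exists_sub_indiff hφ
  obtain ⟨d, hd, H₂⟩ := K.exists_sub_indiff hψ
  obtain ⟨t₁, ht₁, T₁⟩ := K.room fun s => φ s - c
  obtain ⟨t₂, ht₂, T₂⟩ := K.room fun s => ψ s - d
  have ht : 0 < min t₁ t₂ := lt_min ht₁ ht₂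
  obtain ⟨f, hf⟩ := T₁ _ ht (min_le_left _ _)
  obtain ⟨g, hg⟩ := T₂ _ ht (min_le_right _ _)
  have hfo := H₁ _ ht f hf
  have hgo := H₂ _ ht g hg
  have hmix := K.meu.ambiguity_aversion f g
    ⟨K.meu.trans _ _ _ hfo.1 hgo.2, K.meu.trans _ _ _ hgo.1 hfo.2⟩ ⟨1 / 2, by norm_num, by norm_num⟩
  have hmem := (K.mem_acceptable_iff (φ := fun s => φ s + ψ s - c - d) (half_pos ht) fun s => by
    simp only [mix, K.affine, hf, hg]; ring).2 (K.meu.trans _ _ _ hmix hfo.1)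
  refine K.acceptable_mono hmem fun s => ?_
  simp only [Pi.add_apply]
  linarith

theorem convex_acceptable (K : Calibrated hX R₀ R A u o)
    [Nonempty S] : Convex ℝ (acceptable R u o) := by
  intro φ hφ ψ hψ a b ha hb hab
  rcases ha.eq_or_lt with rfl | ha
  · simpa [show b = 1 by linarith] using hψ
  rcases hb.eq_or_lt with rfl | hb
  · simpa [show a = 1 by linarith] using hφ
  exact K.add_mem_acceptable (smul_mem_acceptable hφ ha) (smul_mem_acceptable hψ hb)

/-- A functional separating `φ` from the closed convex cone is nonnegative on the cone. Nonnegative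
profiles are acceptable, so its coefficients are nonnegative and can be normalized to a probability.
-/
theorem exists_prior_of_notMem (K : Calibrated hX R₀ R A u o)
    [Nonempty S] {φ : S → ℝ} (hφ : φ ∉ acceptable R u o) :
    ∃ p ∈ stdSimplex ℝ S, (∀ ψ ∈ acceptable R u o, 0 ≤ ∑ s, ψ s * p s) ∧
      ∑ s, φ s * p s < 0 := by
  classical
  obtain ⟨l, c, h1, h2⟩ := exists_sum_mul_lt K.convex_acceptable K.isClosed_acceptable hφ
  have hc : c < 0 := by simpa using h2 0 K.zero_mem_acceptable
  have hnn : ∀ ψ ∈ acceptable R u o, 0 ≤ ∑ s, ψ s * l s := fun ψ hψ => by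
    by_contra hlt
    rw [not_le] at hlt
    -- This multiple of `ψ` has value exactly `c`, contrary to strict separation.
    have h3 := h2 _ (smul_mem_acceptable hψ (div_pos_of_neg_of_neg hc hlt))
    have h4 : ∑ s, l s * ((c / ∑ s, ψ s * l s) • ψ) s = (c / ∑ s, ψ s * l s) * ∑ s, ψ s * l s := by
      rw [Finset.mul_sum]
      exact Finset.sum_congr rfl fun s _ => by simp only [Pi.smul_apply, smul_eq_mul]; ring
    rw [h4, div_mul_cancel₀ _ hlt.ne] at h3
    exact lt_irrefl _ h3
  have hl : ∀ s, 0 ≤ l s := fun s => by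
    have := hnn (Pi.single s 1) (K.acceptable_mono K.zero_mem_acceptable
      (Pi.single_nonneg.2 zero_le_one))
    simpa [Pi.single_apply] using this
  have hsum : 0 < ∑ s, l s := by
    refine (Finset.sum_nonneg fun s _ => hl s).lt_of_ne fun h0 => ?_
    have : ∀ s, l s = 0 := fun s =>
      (Finset.sum_eq_zero_iff_of_nonneg fun s _ => hl s).1 h0.symm s (Finset.mem_univ s)
    simp only [this, zero_mul, Finset.sum_const_zero] at h1
    linarith
  have key : ∀ ψ : S → ℝ, ∑ s, ψ s * (l s / ∑ s, l s) = (∑ s, ψ s * l s) / ∑ s, l s := fun ψ => by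
    rw [Finset.sum_div]
    exact Finset.sum_congr rfl fun s _ => by ring
  refine ⟨fun s => l s / ∑ s, l s, ⟨fun s => div_nonneg (hl s) hsum.le, ?_⟩, fun ψ hψ => ?_, ?_⟩
  · rw [← Finset.sum_div, div_self hsum.ne']
  · rw [key]
    exact div_nonneg (hnn ψ hψ) hsum.le
  · rw [key]
    refine div_neg_of_neg_of_pos ?_ hsum
    simp_rw [mul_comm (φ _)]
    linarith

end Calibrated

/-- The Gilboa–Schmeidler theorem on a finite state space, for a given utility. -/
theorem ConditionalMEU.exists_isMEU [Fintype S] [Nonempty S] (h : ConditionalMEU hX R₀ R A)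
    (haff : ∀ (t : Icc (0 : ℝ) 1) (x y : X), u (mixX hX t x y) = t * u x + (1 - t) * u y)
    (hnc : ∃ x y : X, u x ≠ u y)
    (hu : ∀ x y : X, R (const S x) (const S y) ↔ u y ≤ u x) :
    ∃ C : Set (S → ℝ), IsMEU hX R u C := by
  obtain ⟨o, ho⟩ := exists_act_of_profile (S := S) haff hnc
  have K : Calibrated hX R₀ R A u o := ⟨h, haff, hu, ho⟩
  let C : Set (S → ℝ) :=
    {p | p ∈ stdSimplex ℝ S ∧ ∀ ψ ∈ acceptable R u o, 0 ≤ ∑ s, ψ s * p s}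
  have hsub : C ⊆ stdSimplex ℝ S := fun p hp => hp.1
  have hne : C.Nonempty := by
    have : (fun _ => -1 : S → ℝ) ∉ acceptable R u o := by
      rw [K.const_mem_acceptable_iff]; norm_num
    obtain ⟨p, hp, hp', -⟩ := K.exists_prior_of_notMem this
    exact ⟨p, hp, hp'⟩
  have hclosed : IsClosed C := by
    have : C = stdSimplex ℝ S ∩ ⋂ ψ ∈ acceptable R u o, {p | 0 ≤ ∑ s, ψ s * p s} := by
      ext p; simp [C]
    rw [this]
    exact (isClosed_stdSimplex ℝ S).inter (isClosed_biInter fun ψ _ =>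
      isClosed_le continuous_const (continuous_sum_mul ψ))
  have hconv : Convex ℝ C := by
    intro p hp q hq a b ha hb hab
    refine ⟨convex_stdSimplex ℝ S hp.1 hq.1 ha hb hab, fun ψ hψ => ?_⟩
    have : ∑ s, ψ s * (a • p + b • q) s = a * ∑ s, ψ s * p s + b * ∑ s, ψ s * q s := by
      rw [Finset.mul_sum, Finset.mul_sum, ← Finset.sum_add_distrib]
      exact Finset.sum_congr rfl fun s _ => by
        simp only [Pi.add_apply, Pi.smul_apply, smul_eq_mul]; ring
    rw [this]
    exact add_nonneg (mul_nonneg ha (hp.2 ψ hψ)) (mul_nonneg hb (hq.2 ψ hψ))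
  -- Duality settles comparisons with constants: a profile outside the cone is refuted by some prior
  -- in `C`.
  have hconst : ∀ (f : S → X) (x : X), R f (const S x) ↔ u x ≤ maxmin u C f := by
    intro f x
    have hsum : ∀ p ∈ C, ∑ s, (u (f s) - u x) * p s = ∑ s, u (f s) * p s - u x := fun p hp => by
      simp only [sub_mul, Finset.sum_sub_distrib]
      rw [sum_const_mul_of_mem_stdSimplex (hsub hp)]
    rw [le_maxmin_iff hsub hne, ← K.mem_acceptable_iff (φ := fun s => u (f s) - u x) one_pos
      fun s => by ring]
    refine ⟨fun hmem p hp => ?_, fun H => ?_⟩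
    · have := hp.2 _ hmem
      rw [hsum p hp] at this
      linarith
    · by_contra hmem
      obtain ⟨p, hp, hp', hlt⟩ := K.exists_prior_of_notMem hmem
      rw [hsum p ⟨hp, hp'⟩] at hlt
      linarith [H p ⟨hp, hp'⟩]
  have hequiv : ∀ f : S → X, ∃ x, u x = maxmin u C f := by
    intro f
    obtain ⟨s₀, h₀⟩ := Finite.exists_min fun s => u (f s)
    obtain ⟨s₁, h₁⟩ := Finite.exists_max fun s => u (f s)
    refine exists_utility_eq haff (a := f s₀) (b := f s₁)
      ((hconst f _).1 (h.of_le hu h₀)) ?_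
    obtain ⟨p, hp⟩ := hne
    refine (maxmin_le_sum hsub hp).trans ?_
    rw [← sum_const_mul_of_mem_stdSimplex (hsub hp) (u (f s₁))]
    exact Finset.sum_le_sum fun s _ => mul_le_mul_of_nonneg_right (h₁ s) ((hsub hp).1 s)
  refine ⟨C, haff, hnc, hsub, hne, hclosed, hconv, fun f g => ?_⟩
  constructor
  · intro hR
    obtain ⟨x, hx⟩ := hequiv g
    rw [← hx]
    exact (hconst f x).1 (h.trans _ _ _ hR ((hconst g x).2 hx.le))
  · intro hle
    by_contra hR
    obtain ⟨x, hx⟩ := hequiv f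
    obtain ⟨y, hy⟩ := hequiv g
    -- Otherwise f ≽ x ≽ y ≽ g. So g ≻ y strictly, and lowering g by a small ε keeps it acceptable
    -- relative to y; its maxmin value would then exceed u(y), which it equals.
    have hyg : ¬ R (const S y) g := fun hyg => hR <|
      h.trans _ _ _ ((hconst f x).2 hx.le) (h.trans _ _ _ ((hu x y).2 (by linarith)) hyg)
    obtain ⟨t, ht, f', hf'⟩ := K.exists_act fun s => u (g s) - u y
    obtain ⟨ε, hε, hmem⟩ := K.exists_sub_mem ht hf' (mt (K.iff_of_profile (t := 1) (f := g) (x := y)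
      one_pos ht (fun s => by ring) hf').2.2 hyg)
    have : u y + ε ≤ maxmin u C g := (le_maxmin_iff hsub hne).2 fun p hp => by
      have h0 := hp.2 _ hmem
      simp only [sub_mul, Finset.sum_sub_distrib] at h0
      rw [sum_const_mul_of_mem_stdSimplex (hsub hp),
        sum_const_mul_of_mem_stdSimplex (hsub hp)] at h0
      linarith
    linarith

end GilboaSchmeidler


/-! ### Bayesian updates of closed convex sets of priors. -/

section Updating

variable {S : Type v} [Fintype S]

theorem prob_eq_sum_mul (p : S → ℝ) (A : Set S) :
    prob p A = ∑ s, A.indicator (fun _ => (1 : ℝ)) s * p s := by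
  classical
  exact Finset.sum_congr rfl fun s _ => by by_cases hs : s ∈ A <;> simp [hs]

theorem continuous_prob (A : Set S) : Continuous fun p : S → ℝ => prob p A := by
  simp_rw [prob_eq_sum_mul]
  exact continuous_sum_mul _

theorem prob_combination (a b : ℝ) (p q : S → ℝ) (A : Set S) :
    prob (a • p + b • q) A = a * prob p A + b * prob q A := by
  simp_rw [prob_eq_sum_mul, Finset.mul_sum, ← Finset.sum_add_distrib]
  exact Finset.sum_congr rfl fun s _ => by
    simp only [Pi.add_apply, Pi.smul_apply, smul_eq_mul]; ring

theorem prob_nonneg {p : S → ℝ} (hp : p ∈ stdSimplex ℝ S) (A : Set S) : 0 ≤ prob p A :=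
  Finset.sum_nonneg fun s _ => indicator_nonneg (fun s _ => hp.1 s) s

theorem prob_le_one {p : S → ℝ} (hp : p ∈ stdSimplex ℝ S) (A : Set S) : prob p A ≤ 1 := by
  rw [← hp.2]
  exact Finset.sum_le_sum fun s _ => indicator_le_self' (fun s _ => hp.1 s) s

theorem bayes_of_notMem (p : S → ℝ) {A : Set S} {s : S} (hs : s ∉ A) : bayes p A s = 0 := by
  simp [bayes, hs]

theorem bayes_mem_stdSimplex {p : S → ℝ} (hp : p ∈ stdSimplex ℝ S) {A : Set S}
    (hA : 0 < prob p A) : bayes p A ∈ stdSimplex ℝ S :=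
  ⟨fun s => div_nonneg (indicator_nonneg (fun s _ => hp.1 s) s) hA.le, by
    simp only [bayes]
    rw [← Finset.sum_div]
    exact div_self hA.ne'⟩

theorem sum_mul_indicator (φ p : S → ℝ) {A : Set S} (hA : prob p A ≠ 0) :
    ∑ s, φ s * A.indicator p s = prob p A * ∑ s, φ s * bayes p A s := by
  rw [Finset.mul_sum]
  exact Finset.sum_congr rfl fun s _ => by simp only [bayes]; field_simp

theorem bayes_eq_iff {p q : S → ℝ} {A : Set S} (hA : prob p A ≠ 0) :
    bayes p A = q ↔ ∀ s, A.indicator p s = q s * prob p A := by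
  rw [funext_iff]
  exact forall_congr' fun s => div_eq_iff hA

theorem continuousOn_bayes (A : Set S) :
    ContinuousOn (fun p : S → ℝ => bayes p A) {p | prob p A ≠ 0} := by
  refine continuousOn_pi.2 fun s => ContinuousOn.div ?_ (continuous_prob A).continuousOn
    fun p hp => hp
  by_cases hs : s ∈ A
  · simpa [hs] using (continuous_apply s).continuousOn
  · simpa [hs] using continuousOn_const

/-- The weighted updates of two probabilities mix to the update of a mixture. -/
theorem exists_bayes_combination {p q : S → ℝ} {A : Set S} (hp : 0 < prob p A) (hq : 0 < prob q A)
    {a b : ℝ} (ha : 0 ≤ a) (hb : 0 ≤ b) (hab : a + b = 1) :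
    ∃ c d : ℝ, 0 ≤ c ∧ 0 ≤ d ∧ c + d = 1 ∧
      a • bayes p A + b • bayes q A = bayes (c • p + d • q) A := by
  -- In an update of c p + d q, the update of p carries weight proportional to c p(A). Hence c and d
  -- are taken proportional to a/p(A) and b/q(A), with this sum as normalizer.
  have hN : 0 < a / prob p A + b / prob q A := by
    rcases ha.eq_or_lt with rfl | ha
    · have : b = 1 := by linarith
      subst this; simpa using hq
    · positivity
  refine ⟨a / prob p A / (a / prob p A + b / prob q A),
    b / prob q A / (a / prob p A + b / prob q A), by positivity, by positivity, ?_, ?_⟩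
  · rw [← add_div, div_self hN.ne']
  have hprob : prob ((a / prob p A / (a / prob p A + b / prob q A)) • p +
      (b / prob q A / (a / prob p A + b / prob q A)) • q) A =
      1 / (a / prob p A + b / prob q A) := by
    rw [prob_combination, ← hab]
    field_simp
  symm
  rw [bayes_eq_iff (by rw [hprob]; positivity)]
  intro s
  rw [hprob]
  by_cases hs : s ∈ A
  · simp only [bayes, indicator_of_mem hs, Pi.add_apply, Pi.smul_apply, smul_eq_mul]
    field_simp
  · simp [bayes, hs]

variable {C : Set (S → ℝ)}

theorem prob_le_maxProb (hsub : C ⊆ stdSimplex ℝ S) (A : Set S) {p : S → ℝ} (hp : p ∈ C) :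
    prob p A ≤ maxProb C A :=
  le_csSup ⟨1, by rintro _ ⟨q, hq, rfl⟩; exact prob_le_one (hsub hq) A⟩ ⟨p, hp, rfl⟩

theorem exists_prob_eq_maxProb (hsub : C ⊆ stdSimplex ℝ S) (hne : C.Nonempty)
    (hclosed : IsClosed C) (A : Set S) : ∃ p ∈ C, prob p A = maxProb C A := by
  obtain ⟨p, hp, h⟩ := (isCompact_of_subset_stdSimplex hsub hclosed).exists_isMaxOn hne
    (continuous_prob A).continuousOn
  refine ⟨p, hp, (prob_le_maxProb hsub A hp).antisymm (csSup_le (hne.image _) ?_)⟩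
  rintro _ ⟨q, hq, rfl⟩
  exact isMaxOn_iff.1 h q hq

theorem maxProb_mem_Icc (hsub : C ⊆ stdSimplex ℝ S) (hne : C.Nonempty)
    (hclosed : IsClosed C) (A : Set S) : maxProb C A ∈ Icc (0 : ℝ) 1 := by
  obtain ⟨p, hp, h⟩ := exists_prob_eq_maxProb hsub hne hclosed A
  rw [← h]
  exact ⟨prob_nonneg (hsub hp) A, prob_le_one (hsub hp) A⟩

theorem isClosed_image_bayes (hsub : C ⊆ stdSimplex ℝ S) (hclosed : IsClosed C) {A : Set S}
    (hA : ∀ p ∈ C, 0 < prob p A) : IsClosed ((fun p => bayes p A) '' C) :=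
  ((isCompact_of_subset_stdSimplex hsub hclosed).image_of_continuousOn
    ((continuousOn_bayes A).mono fun p hp => (hA p hp).ne')).isClosed

theorem convex_image_bayes (hconv : Convex ℝ C) {A : Set S} (hA : ∀ p ∈ C, 0 < prob p A) :
    Convex ℝ ((fun p => bayes p A) '' C) := by
  rintro _ ⟨p, hp, rfl⟩ _ ⟨q, hq, rfl⟩ a b ha hb hab
  obtain ⟨c, d, hc, hd, hcd, h⟩ := exists_bayes_combination (hA p hp) (hA q hq) ha hb hab
  exact ⟨_, hconv hp hq hc hd hcd, h.symm⟩

/-- Among the priors with a given update there is one that makes the event most likely. -/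
theorem exists_max_prob_of_bayes_eq (hsub : C ⊆ stdSimplex ℝ S) (hclosed : IsClosed C)
    {A : Set S} (hA : ∀ p ∈ C, 0 < prob p A) {p₀ : S → ℝ} (hp₀ : p₀ ∈ C) :
    ∃ p ∈ C, bayes p A = bayes p₀ A ∧
      ∀ q ∈ C, bayes q A = bayes p₀ A → prob q A ≤ prob p A := by
  -- Clearing the denominator makes the condition linear in `p`, hence closed.
  have hset : C ∩ {p | bayes p A = bayes p₀ A} =
      C ∩ {p | ∀ s, A.indicator (fun _ => (1 : ℝ)) s * p s = bayes p₀ A s * prob p A} := by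
    ext p
    refine and_congr_right fun hp => ?_
    change bayes p A = bayes p₀ A ↔ _
    rw [bayes_eq_iff (hA p hp).ne']
    refine forall_congr' fun s => ?_
    by_cases hs : s ∈ A <;> simp [hs]
  have hcl : IsClosed (C ∩ {p | bayes p A = bayes p₀ A}) := by
    rw [hset]
    refine hclosed.inter ?_
    simp only [ofPred_forall]
    exact isClosed_iInter fun s => isClosed_eq (by fun_prop)
      (continuous_const.mul (continuous_prob A))
  obtain ⟨p, hp, h⟩ := (isCompact_of_subset_stdSimplex (inter_subset_left.trans hsub)
    hcl).exists_isMaxOn ⟨p₀, hp₀, rfl⟩ (continuous_prob A).continuousOn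
  exact ⟨p, hp.1, hp.2, fun q hq hq' => isMaxOn_iff.1 h q ⟨hq, hq'⟩⟩

end Updating

/-! ### What reductions, bets and the conditional axioms mean for a maxmin preference. -/

section Representation

variable {S : Type v} [Fintype S] {V : Type w} {X : Set V} {u : X → ℝ}

theorem sum_utility_splice (A : Set S) (f : S → X) (x : X) {p : S → ℝ}
    (hp : p ∈ stdSimplex ℝ S) :
    ∑ s, u (splice A f (const S x) s) * p s =
      u x + ∑ s, (u (f s) - u x) * A.indicator p s := by
  conv_rhs => arg 1; rw [← sum_const_mul_of_mem_stdSimplex hp (u x)]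
  rw [← Finset.sum_add_distrib]
  refine Finset.sum_congr rfl fun s _ => ?_
  by_cases hs : s ∈ A
  · simp only [splice, hs, if_true, indicator_of_mem]; ring
  · simp [splice, hs, const]

theorem sum_utility_bet (A : Set S) (x y : X) {p : S → ℝ} (hp : p ∈ stdSimplex ℝ S) :
    ∑ s, u (splice A (const S x) (const S y) s) * p s = u y + (u x - u y) * prob p A := by
  rw [sum_utility_splice A _ _ hp, prob, Finset.mul_sum]
  rfl

variable [AddCommGroup V] [Module ℝ V]
  {hX : Convex ℝ X} {R : Pref S X} {C : Set (S → ℝ)}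

theorem utility_reduce
    (haff : ∀ (t : Icc (0 : ℝ) 1) (x y : X), u (mixX hX t x y) = t * u x + (1 - t) * u y)
    {p : S → ℝ} (hp : p ∈ stdSimplex ℝ S) (f : S → X) :
    u (reduce hX p hp f) = ∑ s, u (f s) * p s := by
  classical
  -- Two-point affinity makes `U` both convex and concave on `X`, so Jensen's inequality in both
  -- directions yields finite mixtures. The value 0 off `X` plays no role.
  let U : V → ℝ := fun v => if h : v ∈ X then u ⟨v, h⟩ else 0
  have hU : ∀ x : X, U x = u x := fun x => by simp [U]
  have hcomb : ∀ x ∈ X, ∀ y ∈ X, ∀ a b : ℝ, 0 ≤ a → 0 ≤ b → a + b = 1 →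
      U (a • x + b • y) = a • U x + b • U y := by
    intro x hx y hy a b ha hb hab
    have h := haff ⟨a, ha, by linarith⟩ ⟨x, hx⟩ ⟨y, hy⟩
    rw [← hU, ← hU, ← hU, coe_mixX] at h
    simpa [show 1 - a = b by linarith] using h
  have hconv : ConvexOn ℝ X U :=
    ⟨hX, fun x hx y hy a b ha hb hab => (hcomb x hx y hy a b ha hb hab).le⟩
  have hconc : ConcaveOn ℝ X U :=
    ⟨hX, fun x hx y hy a b ha hb hab => (hcomb x hx y hy a b ha hb hab).ge⟩
  have h1 := hconv.map_sum_le (t := Finset.univ) (w := p) (p := fun s => (f s : V))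
    (fun s _ => hp.1 s) hp.2 fun s _ => (f s).2
  have h2 := hconc.le_map_sum (t := Finset.univ) (w := p) (p := fun s => (f s : V))
    (fun s _ => hp.1 s) hp.2 fun s _ => (f s).2
  rw [← hU]
  change U (∑ s, p s • (f s : V)) = _
  rw [le_antisymm h1 h2]
  exact Finset.sum_congr rfl fun s _ => by rw [hU, smul_eq_mul, mul_comm]

theorem IsMEU.maxmin_const (M : IsMEU hX R u C) (x : X) : maxmin u C (const S x) = u x :=
  PartialBayes.maxmin_const M.subset M.nonempty x

theorem IsMEU.const_iff (M : IsMEU hX R u C) (x y : X) :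
    R (const S x) (const S y) ↔ u y ≤ u x := by
  rw [M.represents, M.maxmin_const, M.maxmin_const]

theorem IsMEU.strict_iff (M : IsMEU hX R u C) (f g : S → X) :
    Strict R f g ↔ maxmin u C g < maxmin u C f := by
  rw [Strict, M.represents, M.represents, not_le, and_iff_right_iff_imp]
  exact le_of_lt

theorem IsMEU.indiff_iff (M : IsMEU hX R u C) (f g : S → X) :
    Indiff R f g ↔ maxmin u C f = maxmin u C g := by
  rw [Indiff, M.represents, M.represents]
  exact ⟨fun h => le_antisymm h.2 h.1, fun h => ⟨h.ge, h.le⟩⟩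

theorem IsMEU.exists_lt (M : IsMEU hX R u C) : ∃ x y : X, u y < u x := by
  obtain ⟨x, y, h⟩ := M.nonconstant
  exact h.lt_or_gt.elim (fun h => ⟨y, x, h⟩) fun h => ⟨x, y, h⟩

/-- The reductions that a maxmin preference accepts are those by its priors. -/
theorem IsMEU.acceptsReduction_iff (M : IsMEU hX R u C) (p : S → ℝ) :
    AcceptsReduction hX R p ↔ p ∈ C := by
  constructor
  · rintro ⟨hp, H⟩
    by_contra hpC
    -- An act whose profile follows the separating `φ` is worth less under `p` than under every
    -- prior, so its reduction by `p` is rejected.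
    obtain ⟨φ, c, h1, h2⟩ := exists_sum_mul_lt M.convex M.closed hpC
    obtain ⟨o, ho⟩ := exists_act_of_profile (S := S) M.affine M.nonconstant
    obtain ⟨t, ht, H'⟩ := ho φ
    obtain ⟨f, hf⟩ := H' t ht le_rfl
    have key : ∀ q ∈ stdSimplex ℝ S, ∑ s, u (f s) * q s = u o + t * ∑ s, φ s * q s :=
      fun q hq => by
        rw [Finset.mul_sum, ← sum_const_mul_of_mem_stdSimplex hq (u o), ← Finset.sum_add_distrib]
        exact Finset.sum_congr rfl fun s _ => by rw [hf]; ring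
    have h3 := H f
    rw [M.represents, M.maxmin_const, utility_reduce M.affine] at h3
    have h4 : u o + t * c ≤ maxmin u C f :=
      (le_maxmin_iff M.subset M.nonempty).2 fun q hq => by
        rw [key q (M.subset hq)]
        have := mul_le_mul_of_nonneg_left (h2 q hq).le ht.le
        linarith
    rw [key p hp] at h3
    have := mul_lt_mul_of_pos_left h1 ht
    linarith
  · intro hp
    refine ⟨M.subset hp, fun f => ?_⟩
    rw [M.represents, M.maxmin_const, utility_reduce M.affine]
    exact maxmin_le_sum M.subset hp

/-- The bet on A beats its bad prize even in the worst case, hence under each single prior. All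
priors can thus be updated on A. -/
theorem IsMEU.prob_pos (M : IsMEU hX R u C) {A : Set S} (hA : StronglyNonnull R A)
    {p : S → ℝ} (hp : p ∈ C) : 0 < prob p A := by
  obtain ⟨x, y, h⟩ := M.exists_lt
  have h1 := hA x y ((M.strict_iff _ _).2 (by rwa [M.maxmin_const, M.maxmin_const]))
  rw [M.strict_iff, M.maxmin_const] at h1
  have h2 := h1.trans_le (maxmin_le_sum M.subset hp)
  rw [sum_utility_bet A x y (M.subset hp)] at h2
  exact pos_of_mul_pos_right (by linarith : 0 < (u x - u y) * prob p A) (by linarith)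

/-- The bet paying the worse prize on A is evaluated at the prior making A most likely, whichever
two prizes are used. -/
theorem IsMEU.isMaxLikelihood_iff (M : IsMEU hX R u C) (A : Set S) (m : Icc (0 : ℝ) 1) :
    IsMaxLikelihood hX R A m ↔ (m : ℝ) = maxProb C A := by
  have key : ∀ x y : X, u y < u x → (Indiff R (const S (mixX hX m y x))
      (splice A (const S y) (const S x)) ↔ (m : ℝ) = maxProb C A) := by
    intro x y h
    have h1 : maxmin u C (splice A (const S y) (const S x)) =
        u x + (u y - u x) * maxProb C A := by
      apply le_antisymm
      · obtain ⟨p, hp, hpm⟩ := exists_prob_eq_maxProb M.subset M.nonempty M.closed A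
        refine (maxmin_le_sum M.subset hp).trans_eq ?_
        rw [sum_utility_bet A y x (M.subset hp), hpm]
      · refine (le_maxmin_iff M.subset M.nonempty).2 fun p hp => ?_
        rw [sum_utility_bet A y x (M.subset hp)]
        have := mul_le_mul_of_nonpos_left (prob_le_maxProb M.subset A hp)
          (by linarith : u y - u x ≤ 0)
        linarith
    have h2 : u y - u x ≠ 0 := by linarith
    rw [M.indiff_iff, M.maxmin_const, h1, M.affine]
    constructor
    · intro H
      apply mul_left_cancel₀ h2
      linarith
    · intro H
      rw [H]; ring
  constructor
  · rintro ⟨x, y, hxy, H⟩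
    rw [M.strict_iff, M.maxmin_const, M.maxmin_const] at hxy
    exact (key x y hxy).1 H
  · intro H
    obtain ⟨x, y, h⟩ := M.exists_lt
    exact ⟨x, y, (M.strict_iff _ _).2 (by rwa [M.maxmin_const, M.maxmin_const]), (key x y h).2 H⟩

theorem IsMEU.maxmin_mix_const (M : IsMEU hX R u C) (t : Icc (0 : ℝ) 1) (f : S → X) (x : X) :
    maxmin u C (mix hX t f (const S x)) = t * maxmin u C f + (1 - t) * u x := by
  have key : ∀ p ∈ C, ∑ s, u (mix hX t f (const S x) s) * p s =
      t * ∑ s, u (f s) * p s + (1 - t) * u x := fun p hp => by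
    rw [← sum_const_mul_of_mem_stdSimplex (M.subset hp) (u x), Finset.mul_sum, Finset.mul_sum,
      ← Finset.sum_add_distrib]
    exact Finset.sum_congr rfl fun s _ => by simp only [mix, M.affine, const]; ring
  apply le_antisymm
  · obtain ⟨p, hp, h⟩ := exists_maxmin_eq_sum M.subset M.nonempty M.closed (u := u) f
    rw [h, ← key p hp]
    exact maxmin_le_sum M.subset hp
  · refine (le_maxmin_iff M.subset M.nonempty).2 fun p hp => ?_
    rw [key p hp]
    have := mul_le_mul_of_nonneg_left (maxmin_le_sum M.subset hp : maxmin u C f ≤ _) t.2.1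
    linarith

theorem sum_utility_mix
    (haff : ∀ (t : Icc (0 : ℝ) 1) (x y : X), u (mixX hX t x y) = t * u x + (1 - t) * u y)
    (t : Icc (0 : ℝ) 1) (f g : S → X) (p : S → ℝ) :
    ∑ s, u (mix hX t f g s) * p s =
      t * ∑ s, u (f s) * p s + (1 - t) * ∑ s, u (g s) * p s := by
  rw [Finset.mul_sum, Finset.mul_sum, ← Finset.sum_add_distrib]
  exact Finset.sum_congr rfl fun s _ => by simp only [mix, haff]; ring

theorem IsMEU.le_maxmin_mix (M : IsMEU hX R u C) (t : Icc (0 : ℝ) 1) (f g : S → X) :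
    t * maxmin u C f + (1 - t) * maxmin u C g ≤ maxmin u C (mix hX t f g) := by
  refine (le_maxmin_iff M.subset M.nonempty).2 fun p hp => ?_
  rw [sum_utility_mix M.affine]
  exact add_le_add (mul_le_mul_of_nonneg_left (maxmin_le_sum M.subset hp) t.2.1)
    (mul_le_mul_of_nonneg_left (maxmin_le_sum M.subset hp) (sub_nonneg.2 t.2.2))

theorem exists_convex_weight_lt {a b c : ℝ} (h : a < c) :
    ∃ t : Icc (0 : ℝ) 1, (t : ℝ) ∈ Ioo (0 : ℝ) 1 ∧ t * b + (1 - t) * a < c := by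
  -- The weight is small enough that t(b - a) < c - a; the `+ 1` keeps it below 1 when `a = b`.
  have h0 : 0 < (c - a) / (c - a + |b - a| + 1) := by
    have := abs_nonneg (b - a)
    apply div_pos <;> linarith
  have h1 : (c - a) / (c - a + |b - a| + 1) < 1 := by
    have := abs_nonneg (b - a)
    rw [div_lt_one] <;> linarith
  refine ⟨⟨_, h0.le, h1.le⟩, ⟨h0, h1⟩, ?_⟩
  change (c - a) / (c - a + |b - a| + 1) * b + (1 - (c - a) / (c - a + |b - a| + 1)) * a < c
  have hD : 0 < c - a + |b - a| + 1 := by have := abs_nonneg (b - a); linarith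
  have h2 : (c - a) / (c - a + |b - a| + 1) * (b - a) < c - a := by
    rw [div_mul_eq_mul_div, div_lt_iff₀ hD]
    apply mul_lt_mul_of_pos_left _ (by linarith)
    linarith [le_abs_self (b - a)]
  linarith

/-- A maxmin preference with priors concentrated on `A` satisfies the conditional axioms at `A`. -/
theorem IsMEU.conditionalMEU (M : IsMEU hX R u C) {R₀ : Pref S X} {A : Set S}
    (hA : ∀ p ∈ C, ∀ s ∉ A, p s = 0)
    (h₀ : ∀ x y : X, R₀ (const S x) (const S y) ↔ u y ≤ u x) : ConditionalMEU hX R₀ R A where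
  total f g := by
    rw [M.represents, M.represents]
    exact le_total _ _
  trans f g h := by
    rw [M.represents, M.represents, M.represents]
    exact fun h1 h2 => h2.trans h1
  certainty_independence f g x t ht := by
    rw [M.represents, M.represents, M.maxmin_mix_const, M.maxmin_mix_const,
      add_le_add_iff_right, mul_le_mul_iff_right₀ ht]
  continuity f g h hfg hgh := by
    rw [M.strict_iff] at hfg hgh
    -- Concavity bounds the first mixture from below (signs are flipped to reuse the lemma). The
    -- second is bounded from above by its value at a prior minimizing for `h`, where expected
    -- utility is linear.
    obtain ⟨t, ht, htlt⟩ := exists_convex_weight_lt (a := -maxmin u C f) (b := -maxmin u C h)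
      (c := -maxmin u C g) (by linarith)
    obtain ⟨p, hp, hpm⟩ := exists_maxmin_eq_sum M.subset M.nonempty M.closed (u := u) h
    obtain ⟨r, hr, hrlt⟩ := exists_convex_weight_lt (a := maxmin u C h)
      (b := ∑ s, u (f s) * p s) hgh
    refine ⟨⟨1 - t, by linarith [ht.2], by linarith [ht.1]⟩, r,
      ⟨by linarith [ht.2], by linarith [ht.1]⟩, hr, ?_, ?_⟩
    · rw [M.strict_iff]
      refine lt_of_lt_of_le ?_ (M.le_maxmin_mix _ _ _)
      change maxmin u C g < (1 - (t : ℝ)) * maxmin u C f + (1 - (1 - (t : ℝ))) * maxmin u C h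
      linarith
    · rw [M.strict_iff]
      refine (maxmin_le_sum M.subset hp).trans_lt ?_
      rwa [sum_utility_mix M.affine, ← hpm]
  monotonicity f g H := by
    rw [M.represents]
    refine (le_maxmin_iff M.subset M.nonempty).2 fun p hp =>
      (maxmin_le_sum M.subset hp).trans (Finset.sum_le_sum fun s _ => ?_)
    by_cases hs : s ∈ A
    · exact mul_le_mul_of_nonneg_right ((M.const_iff _ _).1 (H s hs)) ((M.subset hp).1 s)
    · simp [hA p hp s hs]
  ambiguity_aversion f g H t := by
    rw [M.indiff_iff] at H
    rw [M.represents]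
    refine le_trans (le_of_eq ?_) (M.le_maxmin_mix t f g)
    rw [← H]; ring
  nondegeneracy := by
    obtain ⟨x, y, h⟩ := M.exists_lt
    exact ⟨const S x, const S y, (M.strict_iff _ _).2 (by rwa [M.maxmin_const, M.maxmin_const])⟩
  ordinal_consistency x y := by rw [h₀, M.const_iff]

end Representation


/-! ### Maximal priors, posteriors and thresholds. -/

section Characterization

variable {S : Type v} [Fintype S] {V : Type w} [AddCommGroup V] [Module ℝ V] {X : Set V}
  {hX : Convex ℝ X} {R R' : Pref S X} {u : X → ℝ} {C : Set (S → ℝ)}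

theorem IsMEU.maxProb_pos (M : IsMEU hX R u C) {A : Set S} (hA : StronglyNonnull R A) :
    0 < maxProb C A := by
  obtain ⟨p, hp⟩ := M.nonempty
  exact (M.prob_pos hA hp).trans_le (prob_le_maxProb M.subset A hp)

theorem IsMEU.isMaximal_iff (M : IsMEU hX R u C) {A : Set S} (hA : StronglyNonnull R A)
    (p : S → ℝ) : IsMaximal hX R A p ↔
      p ∈ C ∧ ∀ q ∈ C, bayes q A = bayes p A → prob q A ≤ prob p A := by
  simp only [IsMaximal, M.acceptsReduction_iff]
  constructor
  · rintro ⟨-, hp, H⟩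
    exact ⟨hp, fun q hq hqp => H q ⟨M.subset hq, M.prob_pos hA hq, hqp⟩ hq⟩
  · rintro ⟨hp, H⟩
    exact ⟨M.prob_pos hA hp, hp, fun q hqp hq => H q hq hqp.2.2⟩

theorem IsMEU.exists_isMaximal (M : IsMEU hX R u C) {A : Set S} (hA : StronglyNonnull R A)
    {p₀ : S → ℝ} (hp₀ : p₀ ∈ C) :
    ∃ p ∈ C, IsMaximal hX R A p ∧ bayes p A = bayes p₀ A ∧ prob p₀ A ≤ prob p A := by
  obtain ⟨p, hp, hpe, H⟩ :=
    exists_max_prob_of_bayes_eq M.subset M.closed (fun p hp => M.prob_pos hA hp) hp₀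
  exact ⟨p, hp, (M.isMaximal_iff hA p).2 ⟨hp, by rwa [hpe]⟩, hpe, H p₀ hp₀ rfl⟩

/-- A maximal probability is at least as likely to be kept by a threshold as any other prior with
the same update. -/
theorem IsMEU.bayes_mem_posteriors_iff (M : IsMEU hX R u C) {A : Set S}
    (hA : StronglyNonnull R A) {p : S → ℝ} (hp : IsMaximal hX R A p) (r : ℝ) :
    bayes p A ∈ posteriors C r A ↔ r ≤ prob p A / maxProb C A := by
  rw [M.isMaximal_iff hA] at hp
  rw [le_div_iff₀ (M.maxProb_pos hA)]
  constructor
  · rintro ⟨q, hq, hr, hqp⟩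
    exact hr.trans (hp.2 q hq hqp.symm)
  · intro hr
    exact ⟨p, hp.1, hr, rfl⟩

/-- Weak planning consistency: every posterior is the update of some prior. -/
theorem IsMEU.exists_bayes_eq (M : IsMEU hX R u C) {A : Set S} (hA : StronglyNonnull R A)
    {D : Set (S → ℝ)} (M' : IsMEU hX R' u D) (hW : WeakPlanningConsistency R R' A)
    {q : S → ℝ} (hq : q ∈ D) : ∃ p ∈ C, bayes p A = q := by
  have hpos : ∀ p ∈ C, 0 < prob p A := fun p hp => M.prob_pos hA hp
  by_contra hne
  -- The updates form a closed convex set, so `q` can be separated from it. The act built from `φ -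
  -- c` has positive expected excess over o under every update, so planning accepts it on A, but
  -- negative excess under `q`.
  obtain ⟨φ, c, h1, h2⟩ := exists_sum_mul_lt (convex_image_bayes M.convex hpos)
    (isClosed_image_bayes M.subset M.closed hpos) hne
  obtain ⟨o, ho⟩ := exists_act_of_profile (S := S) M.affine M.nonconstant
  obtain ⟨t, ht, H⟩ := ho fun s => φ s - c
  obtain ⟨f, hf⟩ := H t ht le_rfl
  have hsum : ∀ p ∈ stdSimplex ℝ S, ∑ s, (u (f s) - u o) * p s = t * (∑ s, φ s * p s - c) :=
    fun p hp => by
      conv_rhs => rw [← sum_const_mul_of_mem_stdSimplex hp c]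
      rw [← Finset.sum_sub_distrib, Finset.mul_sum]
      exact Finset.sum_congr rfl fun s _ => by rw [hf]; ring
  have h3 : R (splice A f (const S o)) (const S o) := by
    rw [M.represents, M.maxmin_const]
    refine (le_maxmin_iff M.subset M.nonempty).2 fun p hp => ?_
    rw [sum_utility_splice A f o (M.subset hp), sum_mul_indicator _ _ (hpos p hp).ne',
      hsum _ (bayes_mem_stdSimplex (M.subset hp) (hpos p hp))]
    have := mul_nonneg (hpos p hp).le (mul_nonneg ht.le (sub_nonneg.2 (h2 _ ⟨p, hp, rfl⟩).le))
    linarith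
  have h4 := hW f o h3
  rw [M'.represents, M'.maxmin_const] at h4
  have h5 := h4.trans (maxmin_le_sum M'.subset hq)
  have h6 := hsum q (M'.subset hq)
  simp only [sub_mul, Finset.sum_sub_distrib] at h6
  rw [sum_const_mul_of_mem_stdSimplex (M'.subset hq)] at h6
  have := mul_neg_of_pos_of_neg ht (sub_neg.2 h1)
  linarith

theorem weakPlanningConsistency_of_posteriors (M : IsMEU hX R u C) {A : Set S}
    (hA : StronglyNonnull R A) {r : ℝ} (M' : IsMEU hX R' u (posteriors C r A)) :
    WeakPlanningConsistency R R' A := by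
  intro f x h
  rw [M.represents, M.maxmin_const] at h
  rw [M'.represents, M'.maxmin_const]
  refine (le_maxmin_iff M'.subset M'.nonempty).2 ?_
  rintro _ ⟨p, hp, hpr, rfl⟩
  have h0 := M.prob_pos hA hp
  have h1 := h.trans (maxmin_le_sum M.subset hp)
  rw [sum_utility_splice A f x (M.subset hp), sum_mul_indicator _ _ h0.ne'] at h1
  simp only [sub_mul, Finset.sum_sub_distrib] at h1
  rw [sum_const_mul_of_mem_stdSimplex (bayes_mem_stdSimplex (M.subset hp) h0)] at h1
  have := nonneg_of_mul_nonneg_right (by linarith :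
    0 ≤ prob p A * (∑ s, u (f s) * bayes p A s - u x)) h0
  linarith

/-- A closed set that contains the updates of all priors above a threshold less than one contains
the updates of those at the threshold. -/
theorem bayes_mem_of_forall_lt (M : IsMEU hX R u C) {A : Set S} (hA : StronglyNonnull R A)
    {D : Set (S → ℝ)} (hD : IsClosed D) {r : ℝ} (hr : r < 1)
    (H : ∀ p ∈ C, r * maxProb C A < prob p A → bayes p A ∈ D)
    {p : S → ℝ} (hp : p ∈ C) (hpr : r * maxProb C A ≤ prob p A) : bayes p A ∈ D := by
  obtain ⟨q, hq, hqm⟩ := exists_prob_eq_maxProb M.subset M.nonempty M.closed A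
  have h0 := M.maxProb_pos hA
  -- Mixing in a prior of maximal likelihood pushes `p` strictly above the threshold because `r <
  -- 1`; then t tends to 0.
  have hmem : ∀ t ∈ Ioo (0 : ℝ) 1, bayes (t • q + (1 - t) • p) A ∈ D := fun t ht => by
    refine H _ (M.convex hq hp ht.1.le (by linarith [ht.2]) (by ring)) ?_
    rw [prob_combination, hqm]
    have h1 : r * maxProb C A < maxProb C A := by nlinarith
    have h2 := mul_lt_mul_of_pos_left h1 ht.1
    have h3 := mul_le_mul_of_nonneg_left hpr (by linarith [ht.2] : 0 ≤ 1 - t)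
    linarith
  have hcont : ContinuousAt (fun t : ℝ => bayes (t • q + (1 - t) • p) A) 0 := by
    have h1 : ContinuousAt (fun p' => bayes p' A) ((0 : ℝ) • q + (1 - (0 : ℝ)) • p) := by
      refine (continuousOn_bayes A).continuousAt ?_
      refine (isOpen_ne.preimage (continuous_prob A)).mem_nhds ?_
      simpa using (M.prob_pos hA hp).ne'
    exact ContinuousAt.comp (f := fun t : ℝ => t • q + (1 - t) • p) h1
      (Continuous.continuousAt (by fun_prop))
  have hlim : Tendsto (fun t : ℝ => bayes (t • q + (1 - t) • p) A) (𝓝[>] 0) (𝓝 (bayes p A)) := by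
    have := hcont.tendsto
    simp only [zero_smul, sub_zero, one_smul, zero_add] at this
    exact this.mono_left nhdsWithin_le_nhds
  exact hD.mem_of_tendsto hlim (by
    filter_upwards [Ioo_mem_nhdsGT one_pos] with t ht using hmem t ht)

end Characterization

/-! ### The equivalence of axioms and representation. -/

section Theorem

/-- It brings the unconditional preference under the conditional axioms. -/
theorem stronglyNonnull_univ {S : Type v} {V : Type w} {X : Set V} (R : Pref S X) :
    StronglyNonnull R univ := by
  intro x y h
  have : splice univ (const S x) (const S y) = const S x := by
    ext s; simp [splice, const]
  rwa [this]

variable {S : Type v} {V : Type w} [AddCommGroup V] [Module ℝ V] {X : Set V}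
  {hX : Convex ℝ X} {E : Set (Set S)} {pref : Set S → Pref S X}

theorem ConditionalMEU.nonempty_states {R₀ R : Pref S X} {A : Set S}
    (h : ConditionalMEU hX R₀ R A) : Nonempty S := by
  by_contra hS
  rw [not_nonempty_iff] at hS
  obtain ⟨f, g, hfg⟩ := h.nondegeneracy
  exact hfg.2 (Subsingleton.elim f g ▸ h.refl f)

theorem ConditionalMEU.exists_utility {R₀ R : Pref S X} {A : Set S}
    (h : ConditionalMEU hX R₀ R A) :
    ∃ u : X → ℝ, (∀ (t : Icc (0 : ℝ) 1) (x y : X),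
        u (mixX hX t x y) = t * u x + (1 - t) * u y) ∧ (∃ x y : X, u x ≠ u y) ∧
      ∀ x y : X, R (const S x) (const S y) ↔ u y ≤ u x := by
  have hnt : ∃ x y : X, ¬ R (const S y) (const S x) := by
    by_contra! hall
    obtain ⟨f, g, hfg⟩ := h.nondegeneracy
    exact hfg.2 (h.monotonicity _ _ fun s _ => hall _ _)
  obtain ⟨u, haff, hu⟩ := exists_affine_utility hX
    (Q := fun x y => R (const S x) (const S y)) (fun x y => h.total _ _)
    (fun x y z => h.trans _ _ _) (fun x y z t ht => h.certainty_independence _ _ z t ht)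
    (fun x y z h1 h2 => by
      obtain ⟨t, -, ht, -, H, -⟩ := h.continuity (const S x) (const S y) (const S z)
        ⟨(h.total _ _).resolve_left h1, h1⟩ ⟨(h.total _ _).resolve_left h2, h2⟩
      exact ⟨t, ht.1, ht.2, H.1⟩) hnt
  obtain ⟨x, y, hxy⟩ := hnt
  exact ⟨u, haff, ⟨x, y, fun heq => hxy ((hu _ _).2 heq.le)⟩, hu⟩

variable [Fintype S]

theorem axioms_of_hasConstantPB (h : HasConstantPB hX E pref) :
    (∀ A ∈ E, StronglyNonnull (pref univ) A →
        ConditionalMEU hX (pref univ) (pref A) A ∧ Consequentialism (pref A) A ∧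
        WeakPlanningConsistency (pref univ) (pref A) A) ∧
      (∀ A ∈ E, StronglyNonnull (pref univ) A → ∀ B ∈ E, StronglyNonnull (pref univ) B →
          MonotoneLikelihoodReduction hX (pref univ) (pref A) (pref B) A B) := by
  obtain ⟨u, C, r, hr, H⟩ := h
  have M := H.prior
  refine ⟨fun A hAE hA => ?_, fun A hAE hA B hBE hB p q mA mB hp hq hmA hmB hle hacc => ?_⟩
  · have M' := H.posterior A hAE hA
    have hcond : ConditionalMEU hX (pref univ) (pref A) A := M'.conditionalMEU
      (by rintro _ ⟨p, -, -, rfl⟩ s hs; exact bayes_of_notMem p hs) M.const_iff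
    refine ⟨hcond, fun f g hfg => ?_, weakPlanningConsistency_of_posteriors M hA M'⟩
    exact ⟨hcond.monotonicity _ _ fun s hs => hfg s hs ▸ hcond.refl _,
      hcond.monotonicity _ _ fun s hs => hfg s hs ▸ hcond.refl _⟩
  · rw [M.isMaxLikelihood_iff] at hmA hmB
    rw [hmA, hmB] at hle
    rw [(H.posterior B hBE hB).acceptsReduction_iff, M.bayes_mem_posteriors_iff hB hq] at hacc
    rw [(H.posterior A hAE hA).acceptsReduction_iff, M.bayes_mem_posteriors_iff hA hp]
    -- Acceptance at B puts the threshold below the ratio of `q`, which is at most that of `p`.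
    exact hacc.trans hle

theorem hasConstantPB_of_axioms (hE : univ ∈ E)
    (h₁ : ∀ A ∈ E, StronglyNonnull (pref univ) A →
        ConditionalMEU hX (pref univ) (pref A) A ∧
        WeakPlanningConsistency (pref univ) (pref A) A)
    (h₂ : ∀ A ∈ E, StronglyNonnull (pref univ) A → ∀ B ∈ E, StronglyNonnull (pref univ) B →
        MonotoneLikelihoodReduction hX (pref univ) (pref A) (pref B) A B) :
    HasConstantPB hX E pref := by
  have hU := stronglyNonnull_univ (pref univ)
  have h₀ := (h₁ univ hE hU).1
  have := h₀.nonempty_states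
  obtain ⟨u, haff, hnc, hu⟩ := h₀.exists_utility
  have hD : ∀ A, ∃ D : Set (S → ℝ), A ∈ E → StronglyNonnull (pref univ) A →
      IsMEU hX (pref A) u D := fun A => by
    by_cases hA : A ∈ E ∧ StronglyNonnull (pref univ) A
    · have hc := (h₁ A hA.1 hA.2).1
      obtain ⟨D, hD⟩ := hc.exists_isMEU haff hnc fun x y =>
        (hc.ordinal_consistency x y).symm.trans (hu x y)
      exact ⟨D, fun _ _ => hD⟩
    · exact ⟨∅, fun h h' => absurd ⟨h, h'⟩ hA⟩
  choose D hD using hD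
  have M := hD univ hE hU
  set C := D univ with hC
  have MLR : ∀ {A}, A ∈ E → StronglyNonnull (pref univ) A → ∀ {B}, B ∈ E →
      StronglyNonnull (pref univ) B → ∀ {p q}, IsMaximal hX (pref univ) A p →
      IsMaximal hX (pref univ) B q → prob q B / maxProb C B ≤ prob p A / maxProb C A →
      bayes q B ∈ D B → bayes p A ∈ D A := by
    intro A hAE hA B hBE hB p q hp hq hle hmem
    rw [← (hD A hAE hA).acceptsReduction_iff]
    rw [← (hD B hBE hB).acceptsReduction_iff] at hmem
    exact h₂ A hAE hA B hBE hB p q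
      ⟨_, maxProb_mem_Icc M.subset M.nonempty M.closed A⟩
      ⟨_, maxProb_mem_Icc M.subset M.nonempty M.closed B⟩ hp hq
      ((M.isMaxLikelihood_iff A _).2 rfl) ((M.isMaxLikelihood_iff B _).2 rfl) hle hmem
  -- The ratios of maximal priors whose updates are kept, pooled over all events; the threshold is
  -- their infimum.
  let L : Set ℝ := {l | ∃ A ∈ E, StronglyNonnull (pref univ) A ∧ ∃ p,
    IsMaximal hX (pref univ) A p ∧ bayes p A ∈ D A ∧ prob p A / maxProb C A = l}
  have hmax : ∀ {A}, A ∈ E → StronglyNonnull (pref univ) A → ∀ q ∈ D A,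
      ∃ p ∈ C, IsMaximal hX (pref univ) A p ∧ bayes p A = q := by
    intro A hAE hA q hq
    obtain ⟨p₀, hp₀, rfl⟩ := M.exists_bayes_eq hA (hD A hAE hA) (h₁ A hAE hA).2 hq
    obtain ⟨p, hp, hpm, hpe, -⟩ := M.exists_isMaximal hA hp₀
    exact ⟨p, hp, hpm, hpe⟩
  have hratio : ∀ {A}, StronglyNonnull (pref univ) A → ∀ {p}, p ∈ C →
      prob p A / maxProb C A ≤ 1 := fun {A} hA {p} hp =>
    (div_le_one (M.maxProb_pos hA)).2 (prob_le_maxProb M.subset A hp)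
  have hL0 : ∀ l ∈ L, 0 ≤ l := by
    rintro _ ⟨A, -, hA, p, hp, -, rfl⟩
    exact div_nonneg hp.1.le (M.maxProb_pos hA).le
  have hbdd : BddBelow L := ⟨0, hL0⟩
  have hmemL : ∀ {A}, A ∈ E → StronglyNonnull (pref univ) A →
      ∃ p ∈ C, IsMaximal hX (pref univ) A p ∧ bayes p A ∈ D A ∧ prob p A / maxProb C A ∈ L := by
    intro A hAE hA
    obtain ⟨q, hq⟩ := (hD A hAE hA).nonempty
    obtain ⟨p, hp, hpm, rfl⟩ := hmax hAE hA q hq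
    exact ⟨p, hp, hpm, hq, A, hAE, hA, p, hpm, hq, rfl⟩
  obtain ⟨p₁, hp₁, -, -, hL1⟩ := hmemL hE hU
  have hr1 : sInf L ≤ 1 := (csInf_le hbdd hL1).trans (hratio hU hp₁)
  refine ⟨u, C, sInf L, ⟨le_csInf ⟨_, hL1⟩ hL0, hr1⟩,
    fun _ _ _ => ⟨le_csInf ⟨_, hL1⟩ hL0, hr1⟩, M, fun A hAE hA => ?_⟩
  suffices posteriors C (sInf L) A = D A by
    rw [this]; exact hD A hAE hA
  have h0 := M.maxProb_pos hA
  have habove : ∀ p ∈ C, sInf L * maxProb C A < prob p A → bayes p A ∈ D A := by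
    intro p hp hlt
    -- The axiom speaks only of maximal priors, so `p` is replaced by one with the same update. Its
    -- ratio exceeds the infimum, hence that of some kept update at some event B.
    obtain ⟨p', -, hp'm, hpe, hle⟩ := M.exists_isMaximal hA hp
    obtain ⟨_, ⟨B, hBE, hB, q, hq, hqD, rfl⟩, hql⟩ :=
      exists_lt_of_csInf_lt ⟨_, hL1⟩ ((lt_div_iff₀ h0).2 (hlt.trans_le hle))
    rw [← hpe]
    exact MLR hAE hA hBE hB hp'm hq hql.le hqD
  apply Subset.antisymm
  · rintro _ ⟨p, hp, hpr, rfl⟩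
    rcases hr1.lt_or_eq with hr | hr
    · exact bayes_mem_of_forall_lt M hA (hD A hAE hA).closed hr habove hp hpr
    -- With threshold 1 there may be no prior strictly above it to approximate from; instead the
    -- ratio of `p'` is at least 1, hence at least that of a kept update at A itself.
    · obtain ⟨q, hq, hqm, hqD, -⟩ := hmemL hAE hA
      obtain ⟨p', -, hp'm, hpe, hle⟩ := M.exists_isMaximal hA hp
      rw [← hpe]
      refine MLR hAE hA hAE hA hp'm hqm ((hratio hA hq).trans ?_) hqD
      rw [hr, one_mul] at hpr
      exact (one_le_div h0).2 (hpr.trans hle)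
  · intro q hq
    obtain ⟨p, hp, hpm, rfl⟩ := hmax hAE hA q hq
    exact (M.bayes_mem_posteriors_iff hA hpm _).2
      (csInf_le hbdd ⟨A, hAE, hA, p, hpm, hq, rfl⟩)

end Theorem

end PartialBayes

theorem theorem3 {S : Type*} [Fintype S] {V : Type*} [AddCommGroup V] [Module ℝ V]
    {X : Set V} (hX : Convex ℝ X) (E : Set (Set S)) (hE : MeasureTheory.IsSetAlgebra E)
    (pref : Set S → PartialBayes.Pref S X) :
    ((∀ A ∈ E, PartialBayes.StronglyNonnull (pref Set.univ) A →
        PartialBayes.ConditionalMEU hX (pref Set.univ) (pref A) A ∧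
        PartialBayes.Consequentialism (pref A) A ∧
        PartialBayes.WeakPlanningConsistency (pref Set.univ) (pref A) A) ∧
      (∀ A ∈ E, PartialBayes.StronglyNonnull (pref Set.univ) A →
        ∀ B ∈ E, PartialBayes.StronglyNonnull (pref Set.univ) B →
          PartialBayes.MonotoneLikelihoodReduction hX
            (pref Set.univ) (pref A) (pref B) A B)) ↔
    PartialBayes.HasConstantPB hX E pref := by
  refine ⟨fun h => PartialBayes.hasConstantPB_of_axioms hE.univ_mem
    (fun A hAE hA => ⟨(h.1 A hAE hA).1, (h.1 A hAE hA).2.2⟩) h.2, fun h =>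
    PartialBayes.axioms_of_hasConstantPB h⟩
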